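/- Let $N\ge 2$ and $n\ge 2$, and let $\Omega\subset\mathbb R^N$ be an open ball $\{|x-x_0|<r\}$, the exterior of a ball $\{|x-x_0|>r\}$ (with $r>0$), or an open half-space $\{\alpha\cdot x>b\}$ (with $\alpha\in\mathbb R^N\setminus\{0\}$, $b\in\mathbb R$). Let $a_1,\dots,a_n$ be pairwise distinct points of the boundary $\partial\Omega$, and put $$V(x)=\sum_{1\le i<j\le n}\frac{|a_i-a_j|^2}{|x-a_i|^2|x-a_j|^2}.$$ Let $D^{1,2}(\Omega)$ be the completion of $C_c^\infty(\Omega)$ with respect to the norm $\big(\int_\Omega|\nabla u|^2\,dx\big)^{1/2}$ (for these domains it is a space of functions in $L^2_{loc}(\Omega)$ with weak gradient in $L^2(\Omega)$), let $H^1_0(\Omega)$ be the closure of $C_c^\infty(\Omega)$ in $H^1(\Omega)$, and define $$\mu^\star(\Omega)=\inf_{u\in D^{1,2}(\Omega)\setminus\{0\}}\frac{\int_\Omega|\nabla u|^2\,dx}{\int_\Omega V u^2\,dx}.$$ Then $$\mu^\star(\Omega)=\frac{N^2}{n^2}.$$ If $\Omega$ is a ball, then $\mu^\star(\Omega)$ is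 attained by some nonzero $u\in H^1_0(\Omega)$ if and only if $n\ge 3$. If $\Omega$ is the exterior of a ball, then $\mu^\star(\Omega)$ is attained by some nonzero $u\in D^{1,2}(\Omega)$ when $N\ge 3$ and $n\ge 3$. If $\Omega$ is a half-space, then $\mu^\star(\Omega)$ is attained by some nonzero $u\in D^{1,2}(\Omega)$ when $n\ge 3$. -/

import Mathlib

open MeasureTheory Filter Topology TopologicalSpace
open scoped ENNReal ContDiff

noncomputable section

namespace MultipolarHardy

/-- The Euclidean space of dimension `N`. -/
abbrev E (N : ℕ) : Type := EuclideanSpace ℝ (Fin N)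

/-- The multi-singular potential
`V(x) = ∑_{i < j} |a i - a j|² / (|x - a i|² |x - a j|²)`. -/
def potential {N n : ℕ} (a : Fin n → E N) (x : E N) : ℝ :=
  ∑ i : Fin n, ∑ j ∈ Finset.Ioi i,
    ‖a i - a j‖ ^ 2 / (‖x - a i‖ ^ 2 * ‖x - a j‖ ^ 2)

/-- `G` is the weak gradient of `u` in the open set `Ω`: for every smooth test function `ψ`
with compact support in `Ω`, `∫_Ω u ∇ψ = - ∫_Ω ψ G`.  (Used only for `u` and `G` that are square
integrable on the compact subsets of `Ω`, so that both integrals converge.) -/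
def IsWeakGradient {N : ℕ} (Ω : Opens (E N)) (u : E N → ℝ) (G : E N → E N) : Prop :=
  ∀ ψ : TestFunction Ω ℝ ⊤,
    ∫ x in (Ω : Set (E N)), u x • gradient ψ x = - ∫ x in (Ω : Set (E N)), ψ x • G x

/-- `u` belongs to `D^{1,2}(Ω)`, with weak gradient `G`.

The space `D^{1,2}(Ω)` is the completion of `C_c^∞(Ω)` for the norm `(∫_Ω |∇φ|²)^{1/2}`; that is,
`∇u = G` runs through the `L²(Ω)`-closure of the gradients of the test functions.
The elements are realized as functions: `u` is the limit in `L²_loc(Ω)` of test functions `φ k`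
whose gradients converge to `G` in `L²(Ω)`.  (On a ball, the exterior of a ball and a half-space
the `L²`-norm on a compact subset of `Ω` is controlled by the gradient norm, so that each element
of the completion is represented by exactly one such function, up to null sets.) -/
structure MemD12 {N : ℕ} (Ω : Opens (E N)) (u : E N → ℝ) (G : E N → E N) : Prop where
  aestronglyMeasurable : AEStronglyMeasurable u (volume.restrict Ω)
  memLp_loc : ∀ K : Set (E N), IsCompact K → K ⊆ Ω → MemLp u 2 (volume.restrict K)
  memLp_grad : MemLp G 2 (volume.restrict Ω)
  weakGradient : IsWeakGradient Ω u G
  approx : ∃ φ : ℕ → TestFunction Ω ℝ ⊤,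
    (∀ K : Set (E N), IsCompact K → K ⊆ Ω →
      Tendsto (fun k => eLpNorm (fun x => φ k x - u x) 2 (volume.restrict K)) atTop (𝓝 0)) ∧
    Tendsto (fun k => eLpNorm (fun x => gradient (φ k) x - G x) 2 (volume.restrict Ω))
      atTop (𝓝 0)

/-- `u` belongs to `H¹₀(Ω)`, the closure of `C_c^∞(Ω)` in `H¹(Ω)`, with weak gradient `G`. -/
structure MemH10 {N : ℕ} (Ω : Opens (E N)) (u : E N → ℝ) (G : E N → E N) : Prop where
  memLp : MemLp u 2 (volume.restrict Ω)
  memLp_grad : MemLp G 2 (volume.restrict Ω)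
  weakGradient : IsWeakGradient Ω u G
  approx : ∃ φ : ℕ → TestFunction Ω ℝ ⊤,
    Tendsto (fun k => eLpNorm (fun x => φ k x - u x) 2 (volume.restrict Ω)) atTop (𝓝 0) ∧
    Tendsto (fun k => eLpNorm (fun x => gradient (φ k) x - G x) 2 (volume.restrict Ω))
      atTop (𝓝 0)

/-- `u` is not the zero element: it does not vanish almost everywhere in `Ω`. -/
def Nontrivial {N : ℕ} (Ω : Opens (E N)) (u : E N → ℝ) : Prop :=
  ¬ u =ᵐ[volume.restrict Ω] 0

/-- The quotient `∫_Ω |G|² / ∫_Ω V u²` in `[0, ∞]`, where `G` stands for `∇u`. -/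
def quotient {N n : ℕ} (Ω : Opens (E N)) (a : Fin n → E N) (u : E N → ℝ) (G : E N → E N) :
    ℝ≥0∞ :=
  (∫⁻ x in (Ω : Set (E N)), ENNReal.ofReal (‖G x‖ ^ 2)) /
    ∫⁻ x in (Ω : Set (E N)), ENNReal.ofReal (potential a x * u x ^ 2)

/-- The optimal Hardy constant `μ*(Ω; a₁, …, aₙ)`: the infimum of the quotient over the nonzero
elements of `D^{1,2}(Ω)`. -/
def hardyConstant {N n : ℕ} (Ω : Opens (E N)) (a : Fin n → E N) : ℝ≥0∞ :=
  sInf {q | ∃ u G, MemD12 Ω u G ∧ Nontrivial Ω u ∧ q = quotient Ω a u G}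

/-- `μ*(Ω)` is attained in `D^{1,2}(Ω)`. -/
def AttainedInD12 {N n : ℕ} (Ω : Opens (E N)) (a : Fin n → E N) : Prop :=
  ∃ u G, MemD12 Ω u G ∧ Nontrivial Ω u ∧ quotient Ω a u G = hardyConstant Ω a

/-- `μ*(Ω)` is attained in `H¹₀(Ω)`. -/
def AttainedInH10 {N n : ℕ} (Ω : Opens (E N)) (a : Fin n → E N) : Prop :=
  ∃ u G, MemH10 Ω u G ∧ Nontrivial Ω u ∧ quotient Ω a u G = hardyConstant Ω a

/-- The open ball of center `x₀` and radius `r`. -/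
def ballDomain {N : ℕ} (x₀ : E N) (r : ℝ) : Opens (E N) :=
  ⟨Metric.ball x₀ r, Metric.isOpen_ball⟩

/-- The exterior `{x : |x - x₀| > r}` of a ball. -/
def exteriorDomain {N : ℕ} (x₀ : E N) (r : ℝ) : Opens (E N) :=
  ⟨(Metric.closedBall x₀ r)ᶜ, Metric.isClosed_closedBall.isOpen_compl⟩

/-- The open half-space `{x : ⟨α, x⟩ > b}`; the upper half-space is `α = (0, …, 0, 1)`, `b = 0`. -/
def halfSpaceDomain {N : ℕ} (α : E N) (b : ℝ) : Opens (E N) :=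
  ⟨{x | b < inner ℝ α x}, isOpen_lt continuous_const (by fun_prop)⟩

end MultipolarHardy

end

/-!
Each of the three domains is `{h > 0}` for some `h(x) = κ |x|² + ⟨ℓ, x⟩ + c`, and the poles lie on
`{h = 0}`. The function `φ(x) = h(x) ∏ᵢ |x - aᵢ| ^ (-N / n)` is positive and solves
`-Δφ = (N / n)² V φ`, so that `F = ∇φ / φ` satisfies `div F + |F|² = -(N / n)² V`. Completing the
square, `∫ |∇u|² = (N / n)² ∫ V u² + ∫ |∇u - u F|²` for test functions, which is the Hardy
inequality with constant `N² / n²`. Cutting `φ` off logarithmically near the boundary and at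
infinity makes the remainder arbitrarily small, so the constant is sharp. For `n ≥ 3` the energy
`∫ V φ²` is finite and `φ` itself is an extremal. Since the remainder of an extremal vanishes, an
extremal on a connected domain is a multiple of `φ`; for `n = 2` on a ball `∫ V φ²` diverges at the
poles, so there is none.
-/

noncomputable section

namespace MultipolarHardy

section ZeroExtension

variable {X Y : Type*} [TopologicalSpace X] [Zero Y] {Ω K : Set X}

lemma tsupport_subset_of_forall_notMem_eq_zero {f : X → Y} (hK : IsClosed K)
    (hf0 : ∀ x ∉ K, f x = 0) : tsupport f ⊆ K :=
  closure_minimal (fun x hx => by_contra fun h => hx (hf0 x h)) hK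

lemma continuous_of_continuousOn_of_eq_zero [TopologicalSpace Y] {f : X → Y} (hΩ : IsOpen Ω)
    (hf : ContinuousOn f Ω) (hK : IsClosed K) (hKΩ : K ⊆ Ω) (hf0 : ∀ x ∉ K, f x = 0) :
    Continuous f :=
  continuous_of_tsupport fun _ hx => hf.continuousAt <| hΩ.mem_nhds <| hKΩ <|
    tsupport_subset_of_forall_notMem_eq_zero hK hf0 hx

lemma integrable_of_continuousOn_of_eq_zero [R1Space X] [MeasurableSpace X]
    [OpensMeasurableSpace X] {μ : Measure X} [IsFiniteMeasureOnCompacts μ] {Y : Type*}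
    [NormedAddCommGroup Y] {f : X → Y} (hΩ : IsOpen Ω) (hf : ContinuousOn f Ω)
    (hK : IsCompact K) (hKc : IsClosed K) (hKΩ : K ⊆ Ω) (hf0 : ∀ x ∉ K, f x = 0) :
    Integrable f μ :=
  (continuous_of_continuousOn_of_eq_zero hΩ hf hKc hKΩ hf0).integrable_of_hasCompactSupport
    (HasCompactSupport.intro hK hf0)

end ZeroExtension

lemma contDiff_of_contDiffOn_of_eq_zero {X Y : Type*} [NormedAddCommGroup X] [NormedSpace ℝ X]
    [NormedAddCommGroup Y] [NormedSpace ℝ Y] {m : WithTop ℕ∞} {Ω K : Set X} {f : X → Y}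
    (hΩ : IsOpen Ω) (hf : ContDiffOn ℝ m f Ω) (hK : IsClosed K) (hKΩ : K ⊆ Ω)
    (hf0 : ∀ x ∉ K, f x = 0) : ContDiff ℝ m f := by
  refine contDiff_iff_contDiffAt.2 fun x => ?_
  by_cases hx : x ∈ K
  · exact hf.contDiffAt (hΩ.mem_nhds (hKΩ hx))
  · refine (contDiffAt_const (c := (0 : Y))).congr_of_eventuallyEq ?_
    filter_upwards [hK.isOpen_compl.mem_nhds hx] with y hy using hf0 y hy

section SquareIntegrable

variable {α Y : Type*} [MeasurableSpace α] [NormedAddCommGroup Y] {μ : Measure α}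

lemma eLpNorm_two_sq (μ : Measure α) (f : α → Y) :
    eLpNorm f 2 μ ^ 2 = ∫⁻ x, ENNReal.ofReal (‖f x‖ ^ 2) ∂μ := by
  have h := eLpNorm_nnreal_pow_eq_lintegral (f := f) (μ := μ) (p := 2) (by simp)
  simp only [NNReal.coe_ofNat, ENNReal.coe_ofNat, ENNReal.rpow_ofNat] at h
  rw [h]
  refine lintegral_congr fun x => ?_
  rw [ENNReal.ofReal_pow (norm_nonneg _), ofReal_norm]

lemma memLp_two_of_lintegral_ne_top {f : α → Y} (hf : AEStronglyMeasurable f μ)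
    (h : ∫⁻ x, ENNReal.ofReal (‖f x‖ ^ 2) ∂μ ≠ ⊤) : MemLp f 2 μ := by
  rw [← eLpNorm_two_sq] at h
  exact ⟨hf, lt_top_iff_ne_top.2 fun h' => h (by rw [h']; simp)⟩

lemma tendsto_eLpNorm_two_zero_of_lintegral {ι : Type*} {l : Filter ι} {f : ι → α → Y}
    (h : Tendsto (fun k => ∫⁻ x, ENNReal.ofReal (‖f k x‖ ^ 2) ∂μ) l (𝓝 0)) :
    Tendsto (fun k => eLpNorm (f k) 2 μ) l (𝓝 0) := by
  simp_rw [← eLpNorm_two_sq] at h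
  have hroot := h.ennrpow_const (1 / 2)
  rw [ENNReal.zero_rpow_of_pos (by norm_num)] at hroot
  refine hroot.congr fun k => ?_
  rw [← ENNReal.rpow_natCast, ← ENNReal.rpow_mul]
  norm_num

lemma tendsto_eLpNorm_two_zero_of_dominated {f : ℕ → α → Y} {g : α → ℝ}
    (hf : ∀ k, AEStronglyMeasurable (f k) μ) (hg : MemLp g 2 μ)
    (hfg : ∀ k, ∀ᵐ x ∂μ, ‖f k x‖ ≤ ‖g x‖)
    (hlim : ∀ᵐ x ∂μ, Tendsto (fun k => f k x) atTop (𝓝 0)) :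
    Tendsto (fun k => eLpNorm (f k) 2 μ) atTop (𝓝 0) := by
  refine tendsto_eLpNorm_two_zero_of_lintegral ?_
  rw [← lintegral_zero (μ := μ)]
  refine tendsto_lintegral_of_dominated_convergence' (fun x => ENNReal.ofReal (‖g x‖ ^ 2))
    (fun k => ((hf k).norm.pow 2).aemeasurable.ennreal_ofReal) (fun k => ?_) ?_ ?_
  · filter_upwards [hfg k] with x hx
    exact ENNReal.ofReal_le_ofReal (pow_le_pow_left₀ (norm_nonneg _) hx 2)
  · rw [← eLpNorm_two_sq]
    exact ENNReal.pow_ne_top hg.eLpNorm_ne_top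
  · filter_upwards [hlim] with x hx
    simpa using ENNReal.tendsto_ofReal (hx.norm.pow 2)

lemma liminf_lintegral_norm_sq_le {f : ℕ → α → Y} {g : α → Y}
    (hf : ∀ k, AEStronglyMeasurable (f k) μ) (hg : AEStronglyMeasurable g μ)
    (h : Tendsto (fun k => eLpNorm (fun x => f k x - g x) 2 μ) atTop (𝓝 0)) :
    liminf (fun k => ∫⁻ x, ENNReal.ofReal (‖f k x‖ ^ 2) ∂μ) atTop ≤
      ∫⁻ x, ENNReal.ofReal (‖g x‖ ^ 2) ∂μ := by
  have hlim : Tendsto (fun k => (eLpNorm (fun x => f k x - g x) 2 μ + eLpNorm g 2 μ) ^ 2) atTop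
      (𝓝 (eLpNorm g 2 μ ^ 2)) := by
    simpa [Function.comp_def] using
      ((ENNReal.continuous_pow 2).tendsto _).comp (h.add_const (eLpNorm g 2 μ))
  simp_rw [← eLpNorm_two_sq]
  rw [← hlim.liminf_eq]
  refine liminf_le_liminf (Eventually.of_forall fun k => pow_le_pow_left' ?_ 2)
  calc eLpNorm (f k) 2 μ
      = eLpNorm ((fun x => f k x - g x) + g) 2 μ := by congr 1; ext1 x; simp
    _ ≤ _ := eLpNorm_add_le ((hf k).sub hg) hg (by norm_num)

end SquareIntegrable

lemma memLp_of_continuousOn_of_isCompact {X Y : Type*} [TopologicalSpace X] [MeasurableSpace X]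
    [OpensMeasurableSpace X] [NormedAddCommGroup Y]
    {μ : Measure X} [IsFiniteMeasureOnCompacts μ] {p : ℝ≥0∞} {K : Set X} {f : X → Y}
    (hK : IsCompact K) (hKm : MeasurableSet K) (hf : ContinuousOn f K) :
    MemLp f p (μ.restrict K) := by
  obtain ⟨C, hC⟩ := hK.exists_bound_of_continuousOn hf
  have : IsFiniteMeasure (μ.restrict K) := ⟨by simpa using hK.measure_lt_top⟩
  refine MemLp.of_bound (hf.aestronglyMeasurable_of_isCompact hK hKm) C ?_
  filter_upwards [ae_restrict_mem hKm] with x hx using hC x hx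

section Gradient

variable {F : Type*} [NormedAddCommGroup F] [InnerProductSpace ℝ F] [CompleteSpace F]

lemma hasGradientAt_add {f g : F → ℝ} {f' g' x : F} (hf : HasGradientAt f f' x)
    (hg : HasGradientAt g g' x) : HasGradientAt (fun y => f y + g y) (f' + g') x := by
  rw [hasGradientAt_iff_hasFDerivAt] at *
  exact (hf.add hg).congr_fderiv (by ext v; simp)

lemma hasGradientAt_sum {ι : Type*} (s : Finset ι) {f : ι → F → ℝ} {f' : ι → F} {x : F}
    (h : ∀ i ∈ s, HasGradientAt (f i) (f' i) x) :
    HasGradientAt (fun y => ∑ i ∈ s, f i y) (∑ i ∈ s, f' i) x := by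
  simp only [hasGradientAt_iff_hasFDerivAt, map_sum] at *
  exact HasFDerivAt.fun_sum h

lemma hasGradientAt_mul {f g : F → ℝ} {f' g' x : F} (hf : HasGradientAt f f' x)
    (hg : HasGradientAt g g' x) :
    HasGradientAt (fun y => f y * g y) (f x • g' + g x • f') x := by
  rw [hasGradientAt_iff_hasFDerivAt] at *
  exact (hf.mul hg).congr_fderiv (by ext v; simp)

lemma hasGradientAt_const_mul {f : F → ℝ} {f' x : F} (t : ℝ) (h : HasGradientAt f f' x) :
    HasGradientAt (fun y => t * f y) (t • f') x := by
  rw [hasGradientAt_iff_hasFDerivAt] at *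
  exact (h.const_mul t).congr_fderiv (by ext v; simp)

lemma hasGradientAt_comp {g : F → ℝ} {g' x : F} {f : ℝ → ℝ} {f' : ℝ}
    (hf : HasDerivAt f f' (g x)) (hg : HasGradientAt g g' x) :
    HasGradientAt (fun y => f (g y)) (f' • g') x := by
  rw [hasGradientAt_iff_hasFDerivAt] at *
  exact (hf.comp_hasFDerivAt x hg).congr_fderiv (by ext v; simp)

lemma hasGradientAt_norm_sub_sq (p x : F) :
    HasGradientAt (fun y => ‖y - p‖ ^ 2) ((2 : ℝ) • (x - p)) x := by
  rw [hasGradientAt_iff_hasFDerivAt]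
  exact ((hasFDerivAt_id x).sub_const p).norm_sq.congr_fderiv (by ext v; simp)

lemma continuous_gradient {f : F → ℝ} (hf : ContDiff ℝ 1 f) : Continuous (gradient f) :=
  (InnerProductSpace.toDual ℝ F).symm.continuous.comp (hf.continuous_fderiv one_ne_zero)

lemma continuousOn_of_hasGradientAt {Ω : Set F} (hΩ : IsOpen Ω) {f : F → ℝ} {G : F → F}
    (hf : ContDiffOn ℝ 1 f Ω) (hG : ∀ x ∈ Ω, HasGradientAt f (G x) x) : ContinuousOn G Ω :=
  ((InnerProductSpace.toDual ℝ F).symm.continuous.comp_continuousOn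
    (hf.continuousOn_fderiv_of_isOpen hΩ le_rfl)).congr fun x hx => (hG x hx).gradient.symm

lemma gradient_eq_zero_of_notMem_tsupport {f : F → ℝ} {x : F} (hx : x ∉ tsupport f) :
    gradient f x = 0 := by
  have hd : fderiv ℝ f x = 0 := by_contra fun h => hx (support_fderiv_subset ℝ h)
  simp [gradient, hd]

end Gradient

section Divergence

variable {F : Type*} [NormedAddCommGroup F] [InnerProductSpace ℝ F]

/-- The divergence of a vector field, as the trace of its derivative; it is `0` where the field is
not differentiable. -/
def divergence (X : F → F) (x : F) : ℝ :=
  LinearMap.trace ℝ F (fderiv ℝ X x)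

/-- The field `X` is differentiable at `x` with divergence `d`. -/
def HasDivergenceAt (X : F → F) (d : ℝ) (x : F) : Prop :=
  ∃ X' : F →L[ℝ] F, HasFDerivAt X X' x ∧ LinearMap.trace ℝ F X' = d

lemma divergence_eq_zero_of_notMem_tsupport {X : F → F} {x : F} (hx : x ∉ tsupport X) :
    divergence X x = 0 := by
  have hd : fderiv ℝ X x = 0 := by_contra fun h => hx (support_fderiv_subset ℝ h)
  simp [divergence, hd]

namespace HasDivergenceAt

variable {X Y : F → F} {d e : ℝ} {x : F}

lemma divergence_eq (h : HasDivergenceAt X d x) : divergence X x = d := by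
  obtain ⟨X', hX, rfl⟩ := h
  rw [divergence, hX.fderiv]

lemma add (hX : HasDivergenceAt X d x) (hY : HasDivergenceAt Y e x) :
    HasDivergenceAt (fun y => X y + Y y) (d + e) x := by
  obtain ⟨X', hX, rfl⟩ := hX
  obtain ⟨Y', hY, rfl⟩ := hY
  exact ⟨X' + Y', hX.add hY, by simp⟩

lemma const_smul (hX : HasDivergenceAt X d x) (t : ℝ) :
    HasDivergenceAt (fun y => t • X y) (t * d) x := by
  obtain ⟨X', hX, rfl⟩ := hX
  exact ⟨t • X', hX.const_smul t, by simp⟩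

lemma sum {ι : Type*} (s : Finset ι) {X : ι → F → F} {d : ι → ℝ}
    (hX : ∀ i, HasDivergenceAt (X i) (d i) x) :
    HasDivergenceAt (fun y => ∑ i ∈ s, X i y) (∑ i ∈ s, d i) x := by
  choose X' hX hd using hX
  refine ⟨∑ i ∈ s, X' i, HasFDerivAt.fun_sum fun i _ => hX i, ?_⟩
  simp only [ContinuousLinearMap.toLinearMap_sum, map_sum, hd]

end HasDivergenceAt

variable [FiniteDimensional ℝ F]

lemma hasDivergenceAt_smul {f : F → ℝ} {X : F → F} {f' x : F} {d : ℝ} (hf : HasGradientAt f f' x)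
    (hX : HasDivergenceAt X d x) :
    HasDivergenceAt (fun y => f y • X y) (f x * d + inner ℝ f' (X x)) x := by
  obtain ⟨X', hX, rfl⟩ := hX
  rw [hasGradientAt_iff_hasFDerivAt] at hf
  refine ⟨_, hf.smul hX, ?_⟩
  simp

lemma hasDivergenceAt_sub_const (p x : F) :
    HasDivergenceAt (fun y => y - p) (Module.finrank ℝ F) x :=
  ⟨_, (hasFDerivAt_id x).sub_const p, LinearMap.trace_id ℝ F⟩

end Divergence

section IntegralOfDerivative

variable {F Y : Type*} [NormedAddCommGroup F] [NormedSpace ℝ F] [MeasurableSpace F]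
  [BorelSpace F] [NormedAddCommGroup Y] [NormedSpace ℝ Y] {μ : Measure F} {f : F → Y}

lemma integrable_fderiv [IsFiniteMeasureOnCompacts μ]
    (hf : ContDiff ℝ 1 f) (hc : HasCompactSupport f) : Integrable (fderiv ℝ f) μ :=
  (hf.continuous_fderiv one_ne_zero).integrable_of_hasCompactSupport (hc.fderiv ℝ)

lemma integral_fderiv_eq_zero [FiniteDimensional ℝ F] [μ.IsAddHaarMeasure]
    (hf : ContDiff ℝ 1 f) (hc : HasCompactSupport f) : ∫ x, fderiv ℝ f x ∂μ = 0 := by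
  ext v
  have hv : Integrable (fun x => fderiv ℝ f x v) μ :=
    (integrable_fderiv hf hc).apply_continuousLinearMap v
  rw [ContinuousLinearMap.integral_apply (integrable_fderiv hf hc)]
  simpa using integral_smul_fderiv_eq_neg_fderiv_smul_of_integrable (f := fun _ => (1 : ℝ))
    (μ := μ) (g := f) (v := v) (by simp) (by simpa using hv)
    (by simpa using hf.continuous.integrable_of_hasCompactSupport hc)
    (fun x _ => differentiableAt_const _) (fun x _ => hf.differentiable one_ne_zero x)

end IntegralOfDerivative

section IntegralOfDivergence

variable {F : Type*} [NormedAddCommGroup F] [InnerProductSpace ℝ F] [FiniteDimensional ℝ F]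
  [MeasurableSpace F] [BorelSpace F] {μ : Measure F} [μ.IsAddHaarMeasure]

lemma integral_gradient_eq_zero {f : F → ℝ} (hf : ContDiff ℝ 1 f) (hc : HasCompactSupport f) :
    ∫ x, gradient f x ∂μ = 0 := by
  let L := (InnerProductSpace.toDual ℝ F).symm.toContinuousLinearEquiv
  calc ∫ x, L (fderiv ℝ f x) ∂μ = L (∫ x, fderiv ℝ f x ∂μ) := L.integral_comp_comm _
    _ = 0 := by rw [integral_fderiv_eq_zero hf hc, map_zero]

lemma integral_divergence_eq_zero {X : F → F} (hX : ContDiff ℝ 1 X) (hc : HasCompactSupport X) :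
    ∫ x, divergence X x ∂μ = 0 := by
  let T : (F →L[ℝ] F) →L[ℝ] ℝ :=
    (LinearMap.trace ℝ F ∘ₗ ContinuousLinearMap.coeLM ℝ).toContinuousLinearMap
  calc ∫ x, T (fderiv ℝ X x) ∂μ = T (∫ x, fderiv ℝ X x ∂μ) :=
        T.integral_comp_comm (integrable_fderiv hX hc)
    _ = 0 := by rw [integral_fderiv_eq_zero hX hc, map_zero]

end IntegralOfDivergence

section TestFunctions

variable {F : Type*} [NormedAddCommGroup F]

/-- A smooth function on `Ω` that vanishes off a compact subset of `Ω`, as a test function. -/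
def testFunctionOf [NormedSpace ℝ F] (Ω : Opens F) (f : F → ℝ) (hf : ContDiffOn ℝ ∞ f Ω) (K : Set F)
    (hK : IsCompact K) (hKΩ : K ⊆ Ω) (hf0 : ∀ x ∉ K, f x = 0) : TestFunction Ω ℝ ⊤ where
  toFun := f
  contDiff' := contDiff_of_contDiffOn_of_eq_zero Ω.isOpen hf hK.isClosed hKΩ hf0
  hasCompactSupport' := HasCompactSupport.intro hK hf0
  tsupport_subset' := (tsupport_subset_of_forall_notMem_eq_zero hK.isClosed hf0).trans hKΩ

@[simp]
lemma testFunctionOf_apply [NormedSpace ℝ F] (Ω : Opens F) (f : F → ℝ) (hf : ContDiffOn ℝ ∞ f Ω)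
    (K : Set F) (hK : IsCompact K) (hKΩ : K ⊆ Ω) (hf0 : ∀ x ∉ K, f x = 0) (x : F) :
    testFunctionOf Ω f hf K hK hKΩ hf0 x = f x := rfl

variable [InnerProductSpace ℝ F] [CompleteSpace F] {Ω : Opens F} (ψ : TestFunction Ω ℝ ⊤)

lemma hasGradientAt_testFunction (x : F) : HasGradientAt ψ (gradient ψ x) x :=
  (ψ.contDiff.differentiable (by simp) x).hasGradientAt

lemma continuous_gradient_testFunction : Continuous (gradient ψ) :=
  continuous_gradient (ψ.contDiff.of_le (by simp))

end TestFunctions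

section WeakGradient

variable {N : ℕ} {Ω : Opens (E N)}

lemma gradient_testFunction_mul {f : E N → ℝ} {G : E N → E N}
    (hG : ∀ x ∈ Ω, HasGradientAt f (G x) x) (ψ : TestFunction Ω ℝ ⊤) (x : E N) :
    gradient (fun y => ψ y * f y) x = f x • gradient ψ x + ψ x • G x := by
  by_cases hx : x ∈ tsupport ψ
  · rw [add_comm]
    exact (hasGradientAt_mul (hasGradientAt_testFunction ψ x)
      (hG x (ψ.tsupport_subset hx))).gradient
  · rw [gradient_eq_zero_of_notMem_tsupport hx, image_eq_zero_of_notMem_tsupport hx,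
      gradient_eq_zero_of_notMem_tsupport fun h => hx (tsupport_mul_subset_left h)]
    simp

lemma isWeakGradient_of_contDiffOn {f : E N → ℝ} {G : E N → E N} (hf : ContDiffOn ℝ 1 f Ω)
    (hG : ∀ x ∈ Ω, HasGradientAt f (G x) x) : IsWeakGradient Ω f G := by
  intro ψ
  have hψ0 : ∀ x ∉ tsupport ψ, ψ x = 0 := fun x => image_eq_zero_of_notMem_tsupport
  have hdψ0 : ∀ x ∉ tsupport ψ, gradient ψ x = 0 := fun x => gradient_eq_zero_of_notMem_tsupport
  have hK : IsCompact (tsupport ψ) := ψ.hasCompactSupport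
  have hψf : ContDiff ℝ 1 (fun x => ψ x * f x) :=
    contDiff_of_contDiffOn_of_eq_zero Ω.isOpen ((ψ.contDiff.of_le (by simp)).contDiffOn.mul hf)
      hK.isClosed ψ.tsupport_subset fun x hx => by rw [hψ0 x hx, zero_mul]
  have hfψ_int : Integrable fun x => f x • gradient ψ x :=
    integrable_of_continuousOn_of_eq_zero Ω.isOpen
      (hf.continuousOn.smul (continuous_gradient_testFunction ψ).continuousOn) hK hK.isClosed
      ψ.tsupport_subset fun x hx => by rw [hdψ0 x hx, smul_zero]
  have hψG_int : Integrable fun x => ψ x • G x :=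
    integrable_of_continuousOn_of_eq_zero Ω.isOpen
      (ψ.continuous.continuousOn.smul (continuousOn_of_hasGradientAt Ω.isOpen hf hG)) hK
      hK.isClosed ψ.tsupport_subset fun x hx => by rw [hψ0 x hx, zero_smul]
  have hsum : (∫ x, f x • gradient ψ x) + ∫ x, ψ x • G x = 0 := by
    rw [← integral_add hfψ_int hψG_int, ← integral_gradient_eq_zero (μ := volume) hψf
      ψ.hasCompactSupport.mul_right]
    exact integral_congr_ae (ae_of_all _ fun x => (gradient_testFunction_mul hG ψ x).symm)
  rw [setIntegral_eq_integral_of_forall_compl_eq_zero fun x hx => ?_,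
    setIntegral_eq_integral_of_forall_compl_eq_zero fun x hx => ?_]
  · exact eq_neg_of_add_eq_zero_left hsum
  · rw [hψ0 x fun h => hx (ψ.tsupport_subset h), zero_smul]
  · rw [hdψ0 x fun h => hx (ψ.tsupport_subset h), smul_zero]

lemma memD12_testFunction (ψ : TestFunction Ω ℝ ⊤) : MemD12 Ω ψ (gradient ψ) where
  aestronglyMeasurable := ψ.continuous.aestronglyMeasurable
  memLp_loc K _ _ := (ψ.continuous.memLp_of_hasCompactSupport ψ.hasCompactSupport).restrict K
  memLp_grad := by
    refine ((continuous_gradient_testFunction ψ).memLp_of_hasCompactSupport (μ := volume) ?_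
      ).restrict Ω
    exact HasCompactSupport.intro ψ.hasCompactSupport
      fun x hx => gradient_eq_zero_of_notMem_tsupport hx
  weakGradient := isWeakGradient_of_contDiffOn (ψ.contDiff.of_le (by simp)).contDiffOn
    fun x _ => hasGradientAt_testFunction ψ x
  approx := ⟨fun _ => ψ, by simp, by simp⟩

lemma MemD12.lintegral_gradient_ne_top {u : E N → ℝ} {G : E N → E N} (h : MemD12 Ω u G) :
    ∫⁻ x in Ω, ENNReal.ofReal (‖G x‖ ^ 2) ≠ ⊤ := by
  rw [← eLpNorm_two_sq]
  exact ENNReal.pow_ne_top h.memLp_grad.eLpNorm_ne_top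

lemma MemH10.memD12 {u : E N → ℝ} {G : E N → E N} (h : MemH10 Ω u G) : MemD12 Ω u G where
  aestronglyMeasurable := h.memLp.1
  memLp_loc K _ hK := h.memLp.mono_measure (Measure.restrict_mono hK le_rfl)
  memLp_grad := h.memLp_grad
  weakGradient := h.weakGradient
  approx := by
    obtain ⟨φ, hφ, hdφ⟩ := h.approx
    refine ⟨φ, fun K _ hK => ?_, hdφ⟩
    exact tendsto_of_tendsto_of_tendsto_of_le_of_le tendsto_const_nhds hφ (fun _ => zero_le)
      fun k => eLpNorm_mono_measure _ (Measure.restrict_mono hK le_rfl)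

lemma MemD12.exists_seq_tendsto_ae {u : E N → ℝ} {G : E N → E N} (h : MemD12 Ω u G)
    {K : Set (E N)} (hK : IsCompact K) (hKΩ : K ⊆ Ω) :
    ∃ θ : ℕ → TestFunction Ω ℝ ⊤,
      (∀ᵐ x ∂volume.restrict K, Tendsto (fun k => θ k x) atTop (𝓝 (u x))) ∧
      (∀ᵐ x ∂volume.restrict K, Tendsto (fun k => gradient (θ k) x) atTop (𝓝 (G x))) ∧
      Tendsto (fun k => eLpNorm (fun x => gradient (θ k) x - G x) 2 (volume.restrict Ω))
        atTop (𝓝 0) := by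
  obtain ⟨φ, hφ, hdφ⟩ := h.approx
  have hle : volume.restrict K ≤ volume.restrict (Ω : Set (E N)) := Measure.restrict_mono hKΩ le_rfl
  obtain ⟨s, hs, hsu⟩ := (tendstoInMeasure_of_tendsto_eLpNorm (p := 2) (by simp)
    (fun k => (φ k).continuous.aestronglyMeasurable) (h.memLp_loc K hK hKΩ).1
    (hφ K hK hKΩ)).exists_seq_tendsto_ae
  have hdφs := hdφ.comp hs.tendsto_atTop
  obtain ⟨r, hr, hrG⟩ := (tendstoInMeasure_of_tendsto_eLpNorm (p := 2) (by simp)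
    (fun k => (continuous_gradient_testFunction (φ (s k))).aestronglyMeasurable)
    (h.memLp_grad.1.mono_measure hle)
    (tendsto_of_tendsto_of_tendsto_of_le_of_le tendsto_const_nhds hdφs (fun _ => zero_le)
      fun k => eLpNorm_mono_measure _ hle)).exists_seq_tendsto_ae
  refine ⟨fun k => φ (s (r k)), ?_, hrG, hdφs.comp hr.tendsto_atTop⟩
  filter_upwards [hsu] with x hx using hx.comp hr.tendsto_atTop

end WeakGradient

lemma exists_compact_exhaustion {X : Type*} [TopologicalSpace X] [LocallyCompactSpace X]
    [SecondCountableTopology X] (Ω : Opens X) :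
    ∃ K : ℕ → Set X, Monotone K ∧ (∀ m, IsCompact (K m)) ∧ ⋃ m, K m = Ω := by
  have : LocallyCompactSpace Ω := Ω.isOpen.locallyCompactSpace
  let C := CompactExhaustion.choice Ω
  refine ⟨fun m => (↑) '' C m, fun i j hij => Set.image_mono (C.subset hij),
    fun m => (C.isCompact m).image continuous_subtype_val, ?_⟩
  rw [← Set.image_iUnion, C.iUnion_eq, Set.image_univ]
  exact Subtype.range_coe

section Riccati

/-- `b` is the logarithmic gradient `∇φ / φ` of a positive solution of `-Δφ = W φ` in `Ω`, with
`W ≥ 0`; the solution itself is eliminated by the Riccati equation `div b = -W - |b|²`. -/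
structure IsRiccatiField {F : Type*} [NormedAddCommGroup F] [InnerProductSpace ℝ F] (Ω : Opens F)
    (b : F → F) (W : F → ℝ) : Prop where
  contDiffOn : ContDiffOn ℝ 1 b Ω
  continuousOn : ContinuousOn W Ω
  nonneg : ∀ x ∈ Ω, 0 ≤ W x
  hasDivergenceAt : ∀ x ∈ Ω, HasDivergenceAt b (-W x - ‖b x‖ ^ 2) x

namespace IsRiccatiField

variable {F : Type*} [NormedAddCommGroup F] [InnerProductSpace ℝ F] [FiniteDimensional ℝ F]
  {Ω : Opens F} {b : F → F} {W : F → ℝ}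

lemma norm_gradient_sq (h : IsRiccatiField Ω b W) (ψ : TestFunction Ω ℝ ⊤) (x : F) :
    ‖gradient ψ x‖ ^ 2 = (‖gradient ψ x - ψ x • b x‖ ^ 2 + W x * ψ x ^ 2) +
      divergence (fun y => ψ y ^ 2 • b y) x := by
  by_cases hx : x ∈ tsupport ψ
  · have hψsq : HasGradientAt (fun y => ψ y ^ 2) ((2 * ψ x) • gradient ψ x) x :=
      hasGradientAt_comp (by simpa using hasDerivAt_pow 2 (ψ x)) (hasGradientAt_testFunction ψ x)
    rw [(hasDivergenceAt_smul hψsq (h.hasDivergenceAt x (ψ.tsupport_subset hx))).divergence_eq,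
      norm_sub_sq_real, norm_smul, inner_smul_right, real_inner_smul_left, mul_pow,
      Real.norm_eq_abs, sq_abs]
    ring
  · have hx' : x ∉ tsupport fun y => ψ y ^ 2 • b y := fun h =>
      hx (closure_mono (Function.support_subset_iff'.2 fun y hy => by
        simp [Function.notMem_support.1 hy]) h)
    rw [divergence_eq_zero_of_notMem_tsupport hx', gradient_eq_zero_of_notMem_tsupport hx,
      image_eq_zero_of_notMem_tsupport hx]
    simp

lemma continuousOn_remainder (h : IsRiccatiField Ω b W) (ψ : TestFunction Ω ℝ ⊤) :
    ContinuousOn (fun x => ‖gradient ψ x - ψ x • b x‖ ^ 2 + W x * ψ x ^ 2) Ω :=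
  (((continuous_gradient_testFunction ψ).continuousOn.sub
    (ψ.continuous.continuousOn.smul h.contDiffOn.continuousOn)).norm.pow 2).add
      (h.continuousOn.mul (ψ.continuous.continuousOn.pow 2))

variable [MeasurableSpace F] [BorelSpace F] {μ : Measure F} [μ.IsAddHaarMeasure]

lemma integral_divergence_sq_smul (h : IsRiccatiField Ω b W) (ψ : TestFunction Ω ℝ ⊤) :
    ∫ x, divergence (fun y => ψ y ^ 2 • b y) x ∂μ = 0 := by
  have h0 : ∀ x ∉ tsupport ψ, ψ x ^ 2 • b x = 0 := fun x hx => by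
    simp [image_eq_zero_of_notMem_tsupport hx]
  refine integral_divergence_eq_zero (contDiff_of_contDiffOn_of_eq_zero Ω.isOpen
    (((ψ.contDiff.of_le (by simp)).pow 2).contDiffOn.smul h.contDiffOn) (isClosed_tsupport ψ)
    ψ.tsupport_subset h0) (HasCompactSupport.intro ψ.hasCompactSupport h0)

lemma lintegral_gradient (h : IsRiccatiField Ω b W) (ψ : TestFunction Ω ℝ ⊤) :
    ∫⁻ x in (Ω : Set F), ENNReal.ofReal (‖gradient ψ x‖ ^ 2) ∂μ =
      ∫⁻ x in (Ω : Set F),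
        ENNReal.ofReal (‖gradient ψ x - ψ x • b x‖ ^ 2 + W x * ψ x ^ 2) ∂μ := by
  have hK : IsCompact (tsupport ψ) := ψ.hasCompactSupport
  have hgrad0 : ∀ x ∉ tsupport ψ, ‖gradient ψ x‖ ^ 2 = 0 := fun x hx => by
    simp [gradient_eq_zero_of_notMem_tsupport hx]
  have hrem0 : ∀ x ∉ tsupport ψ, ‖gradient ψ x - ψ x • b x‖ ^ 2 + W x * ψ x ^ 2 = 0 :=
    fun x hx => by
      simp [gradient_eq_zero_of_notMem_tsupport hx, image_eq_zero_of_notMem_tsupport hx]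
  have hgrad_int : Integrable (fun x => ‖gradient ψ x‖ ^ 2) μ :=
    integrable_of_continuousOn_of_eq_zero Ω.isOpen
      ((continuous_gradient_testFunction ψ).norm.pow 2).continuousOn hK hK.isClosed
      ψ.tsupport_subset hgrad0
  have hrem_int : Integrable (fun x => ‖gradient ψ x - ψ x • b x‖ ^ 2 + W x * ψ x ^ 2) μ :=
    integrable_of_continuousOn_of_eq_zero Ω.isOpen (h.continuousOn_remainder ψ) hK hK.isClosed
      ψ.tsupport_subset hrem0
  have hdiv_int : Integrable (divergence fun y => ψ y ^ 2 • b y) μ :=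
    (hgrad_int.sub hrem_int).congr
      (ae_of_all _ fun x => sub_eq_of_eq_add' (h.norm_gradient_sq ψ x))
  have hrem_nonneg : ∀ᵐ x ∂μ.restrict Ω,
      0 ≤ ‖gradient ψ x - ψ x • b x‖ ^ 2 + W x * ψ x ^ 2 := by
    filter_upwards [ae_restrict_mem Ω.isOpen.measurableSet] with x hx
    have := h.nonneg x hx
    positivity
  rw [← ofReal_integral_eq_lintegral_ofReal hgrad_int.restrict
      (ae_of_all _ fun x => sq_nonneg _),
    ← ofReal_integral_eq_lintegral_ofReal hrem_int.restrict hrem_nonneg,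
    setIntegral_eq_integral_of_forall_compl_eq_zero fun x hx =>
      hgrad0 x fun h => hx (ψ.tsupport_subset h),
    setIntegral_eq_integral_of_forall_compl_eq_zero fun x hx =>
      hrem0 x fun h => hx (ψ.tsupport_subset h),
    integral_congr_ae (ae_of_all _ (h.norm_gradient_sq ψ)), integral_add hrem_int hdiv_int,
    h.integral_divergence_sq_smul, add_zero]

end IsRiccatiField

namespace IsRiccatiField

variable {N : ℕ} {Ω : Opens (E N)} {b : E N → E N} {W : E N → ℝ} {u : E N → ℝ} {G : E N → E N}

lemma setLIntegral_le_of_memD12 (h : IsRiccatiField Ω b W) (hu : MemD12 Ω u G) {K : Set (E N)}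
    (hK : IsCompact K) (hKΩ : K ⊆ Ω) :
    ∫⁻ x in K, ENNReal.ofReal (‖G x - u x • b x‖ ^ 2 + W x * u x ^ 2) ≤
      ∫⁻ x in (Ω : Set (E N)), ENNReal.ofReal (‖G x‖ ^ 2) := by
  obtain ⟨θ, hθu, hθG, hθ⟩ := hu.exists_seq_tendsto_ae hK hKΩ
  have hlim : ∀ᵐ x ∂volume.restrict K, liminf (fun k => ENNReal.ofReal
        (‖gradient (θ k) x - θ k x • b x‖ ^ 2 + W x * θ k x ^ 2)) atTop =
      ENNReal.ofReal (‖G x - u x • b x‖ ^ 2 + W x * u x ^ 2) := by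
    filter_upwards [hθu, hθG] with x hxu hxG
    exact (ENNReal.tendsto_ofReal (((hxG.sub (hxu.smul_const (b x))).norm.pow 2).add
      ((hxu.pow 2).const_mul (W x)))).liminf_eq
  calc ∫⁻ x in K, ENNReal.ofReal (‖G x - u x • b x‖ ^ 2 + W x * u x ^ 2)
      = ∫⁻ x in K, liminf (fun k => ENNReal.ofReal
          (‖gradient (θ k) x - θ k x • b x‖ ^ 2 + W x * θ k x ^ 2)) atTop :=
        (lintegral_congr_ae hlim).symm
    _ ≤ liminf (fun k => ∫⁻ x in K, ENNReal.ofReal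
          (‖gradient (θ k) x - θ k x • b x‖ ^ 2 + W x * θ k x ^ 2)) atTop :=
        lintegral_liminf_le' fun k => ContinuousOn.aemeasurable
          (ENNReal.continuous_ofReal.comp_continuousOn
            ((h.continuousOn_remainder (θ k)).mono hKΩ)) hK.measurableSet
    _ ≤ liminf (fun k => ∫⁻ x in (Ω : Set (E N)),
          ENNReal.ofReal (‖gradient (θ k) x‖ ^ 2)) atTop :=
        liminf_le_liminf (Eventually.of_forall fun k =>
          (lintegral_mono_set hKΩ).trans (h.lintegral_gradient (θ k)).ge)
    _ ≤ ∫⁻ x in (Ω : Set (E N)), ENNReal.ofReal (‖G x‖ ^ 2) :=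
        liminf_lintegral_norm_sq_le
          (fun k => (continuous_gradient_testFunction (θ k)).aestronglyMeasurable)
          hu.memLp_grad.1 hθ

lemma lintegral_le_of_memD12 (h : IsRiccatiField Ω b W) (hu : MemD12 Ω u G) :
    ∫⁻ x in (Ω : Set (E N)), ENNReal.ofReal (‖G x - u x • b x‖ ^ 2 + W x * u x ^ 2) ≤
      ∫⁻ x in (Ω : Set (E N)), ENNReal.ofReal (‖G x‖ ^ 2) := by
  obtain ⟨K, hKmono, hK, hKΩ⟩ := exists_compact_exhaustion Ω
  conv_lhs => rw [← hKΩ]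
  rw [setLIntegral_iUnion_of_directed _ (directed_of_isDirected_le hKmono)]
  exact iSup_le fun m =>
    h.setLIntegral_le_of_memD12 hu (hK m) (hKΩ ▸ Set.subset_iUnion K m)

end IsRiccatiField

end Riccati

section Inversion

variable {F : Type*} [NormedAddCommGroup F] [InnerProductSpace ℝ F]

/-- The vector `(x - p) / |x - p|²` from `p` to the image of `x` under the inversion in the unit
sphere centered at `p`; it is `0` at `x = p`. -/
def inversionField (p x : F) : F :=
  (‖x - p‖ ^ 2)⁻¹ • (x - p)

lemma norm_inversionField_sq (p x : F) : ‖inversionField p x‖ ^ 2 = (‖x - p‖ ^ 2)⁻¹ := by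
  rw [inversionField, norm_smul, mul_pow, norm_inv, norm_pow, norm_norm]
  by_cases h : ‖x - p‖ = 0
  · simp [h]
  · field_simp

lemma hasDivergenceAt_inversionField [FiniteDimensional ℝ F] {p x : F} (hx : x ≠ p) :
    HasDivergenceAt (inversionField p) ((Module.finrank ℝ F - 2) * (‖x - p‖ ^ 2)⁻¹) x := by
  have hsq : ‖x - p‖ ^ 2 ≠ 0 := pow_ne_zero 2 (norm_ne_zero_iff.2 (sub_ne_zero.2 hx))
  have hinv : HasGradientAt (fun y => (‖y - p‖ ^ 2)⁻¹)
      (-((‖x - p‖ ^ 2) ^ 2)⁻¹ • (2 : ℝ) • (x - p)) x :=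
    hasGradientAt_comp (g := fun y => ‖y - p‖ ^ 2) (hasDerivAt_inv hsq)
      (hasGradientAt_norm_sub_sq p x)
  change HasDivergenceAt (fun y => (‖y - p‖ ^ 2)⁻¹ • (y - p)) _ x
  convert hasDivergenceAt_smul hinv (hasDivergenceAt_sub_const p x) using 1
  rw [real_inner_smul_left, real_inner_smul_left, real_inner_self_eq_norm_sq]
  field_simp
  ring

lemma contDiffOn_inversionField {m : WithTop ℕ∞} (p : F) :
    ContDiffOn ℝ m (inversionField p) {p}ᶜ := by
  have h : ContDiff ℝ m fun x : F => x - p := contDiff_id.sub contDiff_const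
  refine ((h.norm_sq ℝ).contDiffOn.inv fun x hx => ?_).smul h.contDiffOn
  exact pow_ne_zero 2 (norm_ne_zero_iff.2 (sub_ne_zero.2 hx))

lemma norm_inversionField_sub_sq {p q x : F} (hp : x ≠ p) (hq : x ≠ q) :
    ‖inversionField p x - inversionField q x‖ ^ 2 =
      ‖p - q‖ ^ 2 / (‖x - p‖ ^ 2 * ‖x - q‖ ^ 2) := by
  have h := dist_div_norm_sq_smul (sub_ne_zero.2 hp) (sub_ne_zero.2 hq) 1
  simp only [one_div, inv_pow, dist_eq_norm, one_pow, sub_sub_sub_cancel_left] at h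
  rw [inversionField, inversionField, h, norm_sub_rev q p, mul_pow, inv_pow, mul_pow]
  ring

end Inversion

section PairwiseSums

variable {ι : Type*} [Fintype ι] [LinearOrder ι] [LocallyFiniteOrderTop ι]
  [LocallyFiniteOrderBot ι]

lemma two_mul_sum_sum_Ioi {R : Type*} [CommSemiring R] (f : ι → ι → R)
    (hf : ∀ i j, f i j = f j i) (hf0 : ∀ i, f i i = 0) :
    2 * ∑ i, ∑ j ∈ Finset.Ioi i, f i j = ∑ i, ∑ j, f i j := by
  have hoff : ∑ i, ∑ j, f i j = ∑ i, ∑ j ∈ {i}ᶜ, f j i := by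
    rw [Finset.sum_comm]
    exact Finset.sum_congr rfl fun i _ => by simp [Fintype.sum_eq_add_sum_compl i, hf0]
  rw [hoff, ← Finset.sum_sum_Ioi_add_eq_sum_sum_off_diag, Finset.mul_sum]
  simp only [Finset.mul_sum, two_mul, hf]

lemma norm_sum_sq_add_sum_Ioi {F : Type*} [NormedAddCommGroup F] [InnerProductSpace ℝ F]
    (v : ι → F) :
    ‖∑ i, v i‖ ^ 2 + ∑ i, ∑ j ∈ Finset.Ioi i, ‖v i - v j‖ ^ 2 =
      Fintype.card ι * ∑ i, ‖v i‖ ^ 2 := by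
  have h := two_mul_sum_sum_Ioi (fun i j => ‖v i - v j‖ ^ 2) (fun i j => by rw [norm_sub_rev])
    fun i => by simp
  have hinner : ‖∑ i, v i‖ ^ 2 = ∑ i, ∑ j, inner ℝ (v i) (v j) := by
    rw [← real_inner_self_eq_norm_sq, sum_inner]
    simp only [inner_sum]
  have hexpand : ∑ i, ∑ j, ‖v i - v j‖ ^ 2 =
      2 * (Fintype.card ι * ∑ i, ‖v i‖ ^ 2) - 2 * ‖∑ i, v i‖ ^ 2 := by
    simp only [hinner, norm_sub_sq_real, Finset.sum_add_distrib, Finset.sum_sub_distrib,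
      ← Finset.mul_sum, Finset.sum_const, Finset.card_univ, nsmul_eq_mul]
    ring
  linarith

end PairwiseSums

variable {N n : ℕ}

lemma potential_nonneg (a : Fin n → E N) (x : E N) : 0 ≤ potential a x :=
  Finset.sum_nonneg fun _ _ => Finset.sum_nonneg fun _ _ => by positivity

lemma potential_eq {a : Fin n → E N} {x : E N} (hx : ∀ i, x ≠ a i) : potential a x =
    n * ∑ i, ‖inversionField (a i) x‖ ^ 2 - ‖∑ i, inversionField (a i) x‖ ^ 2 := by
  have h := norm_sum_sq_add_sum_Ioi fun i => inversionField (a i) x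
  rw [Fintype.card_fin] at h
  rw [← h, potential, add_sub_cancel_left]
  exact Finset.sum_congr rfl fun i _ => Finset.sum_congr rfl fun j _ =>
    (norm_inversionField_sub_sq (hx i) (hx j)).symm

/-- A region `{h > 0}` for a function `h x = κ |x|² + ⟨ℓ, x⟩ + c`, with distinct poles on
`{h = 0}`: balls, exteriors of balls and half-spaces are of this kind. -/
structure PoleData (N n : ℕ) where
  /-- The coefficient `κ` of `|x|²`. -/
  curv : ℝ
  /-- The linear part `ℓ`. -/
  lin : E N
  /-- The constant term `c`. -/
  cst : ℝ
  /-- The poles. -/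
  pole : Fin n → E N
  injective : Function.Injective pole
  height_pole : ∀ i, curv * ‖pole i‖ ^ 2 + inner ℝ lin (pole i) + cst = 0

namespace PoleData

variable (P : PoleData N n)

/-- The quadratic function `h` that defines the region. -/
def height (x : E N) : ℝ :=
  P.curv * ‖x‖ ^ 2 + inner ℝ P.lin x + P.cst

/-- The gradient of the height. -/
def heightGrad (x : E N) : E N :=
  (2 * P.curv) • x + P.lin

lemma contDiff_height {m : WithTop ℕ∞} : ContDiff ℝ m P.height :=
  ((contDiff_const.mul (contDiff_norm_sq ℝ)).add
    (contDiff_const.inner ℝ contDiff_id)).add contDiff_const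

lemma contDiff_heightGrad {m : WithTop ℕ∞} : ContDiff ℝ m P.heightGrad :=
  (contDiff_id.const_smul (2 * P.curv)).add contDiff_const

lemma hasGradientAt_height (x : E N) : HasGradientAt P.height (P.heightGrad x) x := by
  have hsq := hasGradientAt_norm_sub_sq (0 : E N) x
  rw [hasGradientAt_iff_hasFDerivAt] at *
  simp only [sub_zero] at hsq
  refine (((hsq.const_mul P.curv).add (innerSL ℝ P.lin).hasFDerivAt).add_const P.cst
    ).congr_fderiv ?_
  ext v
  simp only [heightGrad, map_smul, map_add, add_apply, smul_apply,
    InnerProductSpace.toDual_apply_apply, smul_eq_mul, innerSL_apply_apply]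
  ring

lemma hasDivergenceAt_heightGrad (x : E N) :
    HasDivergenceAt P.heightGrad (2 * P.curv * N) x :=
  ⟨(2 * P.curv) • ContinuousLinearMap.id ℝ (E N),
    ((hasFDerivAt_id x).const_smul (2 * P.curv)).add_const P.lin, by simp⟩

/-- The region `{h > 0}`. -/
def domain : Opens (E N) :=
  ⟨{x | 0 < P.height x}, isOpen_lt continuous_const (P.contDiff_height (m := 0)).continuous⟩

/-- The exponent `N / n`. -/
def expo (_ : PoleData N n) : ℝ :=
  N / n

lemma expo_mul (hn : n ≠ 0) : P.expo * n = N :=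
  div_mul_cancel₀ _ (Nat.cast_ne_zero.2 hn)

lemma expo_nonneg : 0 ≤ P.expo :=
  div_nonneg N.cast_nonneg n.cast_nonneg

lemma expo_pos (hN : N ≠ 0) (hn : n ≠ 0) : 0 < P.expo :=
  div_pos (by positivity) (by positivity)

lemma two_mul_expo_le (hn : 2 ≤ n) : 2 * P.expo ≤ N := by
  rw [← P.expo_mul (by lia), mul_comm]
  exact mul_le_mul_of_nonneg_left (by exact_mod_cast hn) P.expo_nonneg

/-- The weight `∏ i, |x - a i| ^ (-N / n)`; at a pole, where it should be infinite, it carries the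
junk value obtained from `log 0 = 0`. -/
def weight (x : E N) : ℝ :=
  Real.exp (-(P.expo / 2) * ∑ i, Real.log (‖x - P.pole i‖ ^ 2))

/-- The positive solution `h(x) ∏ i, |x - a i| ^ (-N / n)` of `-Δφ = (N / n)² V φ`. -/
def groundState (x : E N) : ℝ :=
  P.height x * P.weight x

/-- The logarithmic gradient of the ground state. -/
def logGrad (x : E N) : E N :=
  (P.height x)⁻¹ • P.heightGrad x + (-P.expo) • ∑ i, inversionField (P.pole i) x

variable {P} {x : E N}

lemma mem_domain : x ∈ P.domain ↔ 0 < P.height x := Iff.rfl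

lemma ne_pole (hx : x ∈ P.domain) (i : Fin n) : x ≠ P.pole i := by
  rintro rfl
  exact hx.ne' (P.height_pole i)

lemma norm_sub_pole_pos (hx : x ∈ P.domain) (i : Fin n) : 0 < ‖x - P.pole i‖ :=
  norm_pos_iff.2 (sub_ne_zero.2 (ne_pole hx i))

lemma weight_pos (P : PoleData N n) (x : E N) : 0 < P.weight x := Real.exp_pos _

lemma groundState_pos (hx : x ∈ P.domain) : 0 < P.groundState x :=
  mul_pos hx (P.weight_pos x)

lemma continuousOn_potential (P : PoleData N n) :
    ContinuousOn (potential P.pole) P.domain := by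
  refine continuousOn_finsetSum _ fun i _ => continuousOn_finsetSum _ fun j _ => ?_
  refine ContinuousOn.div continuousOn_const (by fun_prop) fun x hx => ?_
  have hi := norm_sub_pole_pos hx i
  have hj := norm_sub_pole_pos hx j
  positivity

lemma contDiffOn_logGrad {m : WithTop ℕ∞} (P : PoleData N n) :
    ContDiffOn ℝ m P.logGrad P.domain :=
  ((P.contDiff_height.contDiffOn.inv fun _ hx => (mem_domain.1 hx).ne').smul
    P.contDiff_heightGrad.contDiffOn).add (ContDiffOn.const_smul _ (ContDiffOn.sum fun i _ =>
      (contDiffOn_inversionField (P.pole i)).mono fun _ hx => ne_pole hx i))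

lemma contDiffOn_weight {m : WithTop ℕ∞} (P : PoleData N n) :
    ContDiffOn ℝ m P.weight P.domain := by
  refine Real.contDiff_exp.comp_contDiffOn (contDiffOn_const.mul (ContDiffOn.sum fun i _ => ?_))
  have h : ContDiff ℝ m fun x : E N => x - P.pole i := contDiff_id.sub contDiff_const
  exact (h.norm_sq ℝ).contDiffOn.log fun x hx => (pow_pos (norm_sub_pole_pos hx i) 2).ne'

lemma contDiffOn_groundState {m : WithTop ℕ∞} (P : PoleData N n) :
    ContDiffOn ℝ m P.groundState P.domain :=
  P.contDiff_height.contDiffOn.mul P.contDiffOn_weight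

lemma hasGradientAt_weight (hx : x ∈ P.domain) : HasGradientAt P.weight
    (P.weight x • (-P.expo) • ∑ i, inversionField (P.pole i) x) x := by
  have hlog : ∀ i, HasGradientAt (fun y => Real.log (‖y - P.pole i‖ ^ 2))
      ((2 : ℝ) • inversionField (P.pole i) x) x := fun i => by
    rw [inversionField, smul_comm]
    exact hasGradientAt_comp (g := fun y => ‖y - P.pole i‖ ^ 2)
      (Real.hasDerivAt_log (pow_pos (norm_sub_pole_pos hx i) 2).ne')
      (hasGradientAt_norm_sub_sq (P.pole i) x)
  change HasGradientAt
    (fun y => Real.exp (-(P.expo / 2) * ∑ i, Real.log (‖y - P.pole i‖ ^ 2))) _ x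
  convert hasGradientAt_comp (Real.hasDerivAt_exp _) (hasGradientAt_const_mul (-(P.expo / 2))
    (hasGradientAt_sum Finset.univ fun i _ => hlog i)) using 1
  rw [← Finset.smul_sum, smul_smul (-(P.expo / 2)), neg_mul _ (2 : ℝ),
    div_mul_cancel₀ _ two_ne_zero]
  rfl

lemma hasGradientAt_groundState (hx : x ∈ P.domain) :
    HasGradientAt P.groundState (P.groundState x • P.logGrad x) x := by
  change HasGradientAt (fun y => P.height y * P.weight y) _ x
  convert hasGradientAt_mul (P.hasGradientAt_height x) (hasGradientAt_weight hx) using 1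
  have hh : P.height x ≠ 0 := (mem_domain.1 hx).ne'
  rw [groundState, logGrad, smul_add, smul_smul, mul_right_comm, mul_inv_cancel₀ hh, one_mul,
    mul_smul, add_comm]

lemma inner_heightGrad_sub_pole (P : PoleData N n) (x : E N) (i : Fin n) :
    inner ℝ (P.heightGrad x) (x - P.pole i) = P.height x + P.curv * ‖x - P.pole i‖ ^ 2 := by
  have := P.height_pole i
  rw [height, heightGrad, norm_sub_sq_real, inner_add_left, real_inner_smul_left, inner_sub_right,
    inner_sub_right, real_inner_self_eq_norm_sq]
  linarith

lemma inner_heightGrad_sum_inversionField (hx : x ∈ P.domain) :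
    inner ℝ (P.heightGrad x) (∑ i, inversionField (P.pole i) x) =
      P.height x * ∑ i, (‖x - P.pole i‖ ^ 2)⁻¹ + n * P.curv := by
  have h : ∀ i, inner ℝ (P.heightGrad x) (inversionField (P.pole i) x) =
      P.height x * (‖x - P.pole i‖ ^ 2)⁻¹ + P.curv := fun i => by
    have hi := (norm_sub_pole_pos hx i).ne'
    rw [inversionField, inner_smul_right, inner_heightGrad_sub_pole]
    field_simp
  simp only [inner_sum, h, Finset.sum_add_distrib, ← Finset.mul_sum, Finset.sum_const,
    Finset.card_univ, Fintype.card_fin, nsmul_eq_mul]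

lemma hasDivergenceAt_logGrad (hx : x ∈ P.domain) : HasDivergenceAt P.logGrad
    ((P.height x)⁻¹ * (2 * P.curv * N) - (P.height x)⁻¹ ^ 2 * ‖P.heightGrad x‖ ^ 2 -
      P.expo * ((N - 2) * ∑ i, (‖x - P.pole i‖ ^ 2)⁻¹)) x := by
  change HasDivergenceAt (fun y => (P.height y)⁻¹ • P.heightGrad y +
    (-P.expo) • ∑ i, inversionField (P.pole i) y) _ x
  convert (hasDivergenceAt_smul (hasGradientAt_comp (hasDerivAt_inv (mem_domain.1 hx).ne')
    (P.hasGradientAt_height x)) (P.hasDivergenceAt_heightGrad x)).add ((HasDivergenceAt.sum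
      Finset.univ fun i => hasDivergenceAt_inversionField (ne_pole hx i)).const_smul
        (-P.expo)) using 1
  rw [real_inner_smul_left, real_inner_self_eq_norm_sq, finrank_euclideanSpace_fin,
    ← Finset.mul_sum]
  ring

lemma isRiccatiField (hn : n ≠ 0) (P : PoleData N n) :
    IsRiccatiField P.domain P.logGrad fun x => P.expo ^ 2 * potential P.pole x where
  contDiffOn := P.contDiffOn_logGrad
  continuousOn := continuousOn_const.mul P.continuousOn_potential
  nonneg x _ := mul_nonneg (sq_nonneg _) (potential_nonneg _ _)
  hasDivergenceAt x hx := by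
    have hh : P.height x ≠ 0 := (mem_domain.1 hx).ne'
    convert hasDivergenceAt_logGrad hx using 1
    rw [potential_eq (ne_pole hx), logGrad, norm_add_sq_real, real_inner_smul_left,
      inner_smul_right, inner_heightGrad_sum_inversionField hx, norm_smul, norm_smul, mul_pow,
      mul_pow, Real.norm_eq_abs, Real.norm_eq_abs, sq_abs, sq_abs]
    simp only [norm_inversionField_sq, ← P.expo_mul hn]
    field_simp
    ring

end PoleData

/-- The kernel `t ^ (-d) (t / (1 + t)²) ^ s`, which is integrable as a function of the distance to
a point of a `d`-dimensional space, with integral `O(1 / s)`. -/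
def radialKernel (d : ℕ) (s t : ℝ) : ℝ :=
  t ^ (-(d : ℝ)) * (t / (1 + t) ^ 2) ^ s

lemma radialKernel_nonneg (d : ℕ) (s : ℝ) {t : ℝ} (ht : 0 ≤ t) : 0 ≤ radialKernel d s t := by
  unfold radialKernel
  positivity

lemma measurable_radialKernel (d : ℕ) (s : ℝ) : Measurable (radialKernel d s) := by
  unfold radialKernel
  fun_prop

lemma pow_mul_radialKernel {d : ℕ} (hd : d ≠ 0) (s : ℝ) {t : ℝ} (ht : 0 < t) :
    t ^ (d - 1) * radialKernel d s t = t⁻¹ * (t / (1 + t) ^ 2) ^ s := by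
  rw [radialKernel, ← mul_assoc, Real.rpow_neg ht.le, Real.rpow_natCast, pow_sub₀ _ ht.ne'
    (Nat.one_le_iff_ne_zero.2 hd), pow_one, mul_right_comm (t ^ d),
    mul_inv_cancel₀ (pow_pos ht d).ne', one_mul]

lemma inv_mul_rpow_le_rpow_sub_one {s t : ℝ} (hs : 0 < s) (ht : 0 < t) :
    t⁻¹ * (t / (1 + t) ^ 2) ^ s ≤ t ^ (s - 1) := by
  rw [Real.rpow_sub_one ht.ne', div_eq_inv_mul (t ^ s)]
  gcongr
  exact div_le_self ht.le (one_le_pow₀ (by linarith))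

lemma inv_mul_rpow_le_rpow_neg_sub_one {s t : ℝ} (hs : 0 < s) (ht : 0 < t) :
    t⁻¹ * (t / (1 + t) ^ 2) ^ s ≤ t ^ (-s - 1) := by
  rw [Real.rpow_sub_one ht.ne', div_eq_inv_mul (t ^ (-s)), Real.rpow_neg ht.le,
    ← Real.inv_rpow ht.le]
  gcongr
  rw [div_le_iff₀ (by positivity), ← div_eq_inv_mul, le_div_iff₀ ht]
  nlinarith

lemma integrableOn_Ioc_inv_mul_rpow {s : ℝ} (hs : 0 < s) :
    IntegrableOn (fun t : ℝ => t⁻¹ * (t / (1 + t) ^ 2) ^ s) (Set.Ioc 0 1) := by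
  refine Integrable.mono' ((intervalIntegrable_iff_integrableOn_Ioc_of_le zero_le_one).1
    (intervalIntegral.intervalIntegrable_rpow' (r := s - 1) (by linarith)))
    (by fun_prop) ((ae_restrict_mem measurableSet_Ioc).mono fun t ht => ?_)
  have ht0 := ht.1
  rw [Real.norm_of_nonneg (by positivity)]
  exact inv_mul_rpow_le_rpow_sub_one hs ht0

lemma integrableOn_Ioi_one_inv_mul_rpow {s : ℝ} (hs : 0 < s) :
    IntegrableOn (fun t : ℝ => t⁻¹ * (t / (1 + t) ^ 2) ^ s) (Set.Ioi 1) := by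
  refine Integrable.mono' (integrableOn_Ioi_rpow_of_lt (a := -s - 1) (by linarith) one_pos)
    (by fun_prop) ((ae_restrict_mem measurableSet_Ioi).mono fun t ht => ?_)
  have ht0 : 0 < t := one_pos.trans ht
  rw [Real.norm_of_nonneg (by positivity)]
  exact inv_mul_rpow_le_rpow_neg_sub_one hs ht0

lemma integrableOn_Ioi_inv_mul_rpow {s : ℝ} (hs : 0 < s) :
    IntegrableOn (fun t : ℝ => t⁻¹ * (t / (1 + t) ^ 2) ^ s) (Set.Ioi 0) := by
  rw [← Set.Ioc_union_Ioi_eq_Ioi (zero_le_one (α := ℝ))]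
  exact (integrableOn_Ioc_inv_mul_rpow hs).union (integrableOn_Ioi_one_inv_mul_rpow hs)

lemma integral_Ioi_inv_mul_rpow_le {s : ℝ} (hs : 0 < s) :
    ∫ t in Set.Ioi (0 : ℝ), t⁻¹ * (t / (1 + t) ^ 2) ^ s ≤ 2 / s := by
  have hleft : ∫ t in Set.Ioc (0 : ℝ) 1, t⁻¹ * (t / (1 + t) ^ 2) ^ s ≤ 1 / s := by
    have hle := setIntegral_mono_on (integrableOn_Ioc_inv_mul_rpow hs)
      ((intervalIntegrable_iff_integrableOn_Ioc_of_le zero_le_one).1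
        (intervalIntegral.intervalIntegrable_rpow' (r := s - 1) (by linarith)))
      measurableSet_Ioc fun t ht => inv_mul_rpow_le_rpow_sub_one hs ht.1
    rwa [← intervalIntegral.integral_of_le zero_le_one (f := fun t : ℝ => t ^ (s - 1)),
      integral_rpow (Or.inl (by linarith)), sub_add_cancel, Real.one_rpow,
      Real.zero_rpow hs.ne', sub_zero] at hle
  have hright : ∫ t in Set.Ioi (1 : ℝ), t⁻¹ * (t / (1 + t) ^ 2) ^ s ≤ 1 / s := by
    have hle := setIntegral_mono_on (integrableOn_Ioi_one_inv_mul_rpow hs)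
      (integrableOn_Ioi_rpow_of_lt (a := -s - 1) (by linarith) one_pos) measurableSet_Ioi
      fun t ht => inv_mul_rpow_le_rpow_neg_sub_one hs (one_pos.trans ht)
    rwa [integral_Ioi_rpow_of_lt (by linarith) one_pos, sub_add_cancel, Real.one_rpow,
      neg_div_neg_eq] at hle
  rw [← Set.Ioc_union_Ioi_eq_Ioi (zero_le_one (α := ℝ)), setIntegral_union
    Set.Ioc_disjoint_Ioi_same measurableSet_Ioi (integrableOn_Ioc_inv_mul_rpow hs)
    (integrableOn_Ioi_one_inv_mul_rpow hs)]
  calc _ ≤ 1 / s + 1 / s := add_le_add hleft hright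
    _ = 2 / s := by ring

lemma exists_lintegral_radialKernel_le {F : Type*} [NormedAddCommGroup F] [NormedSpace ℝ F]
    [FiniteDimensional ℝ F] [_root_.Nontrivial F] [MeasurableSpace F] [BorelSpace F] (μ : Measure F)
    [μ.IsAddHaarMeasure] : ∃ C : ℝ, ∀ s, 0 < s → ∀ p : F,
      ∫⁻ x, ENNReal.ofReal (radialKernel (Module.finrank ℝ F) s ‖x - p‖) ∂μ ≤
        ENNReal.ofReal (C / s) := by
  set d := Module.finrank ℝ F
  refine ⟨d * μ.real (Metric.ball 0 1) * 2, fun s hs p => ?_⟩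
  have hradial : Set.EqOn (fun t : ℝ => t ^ (d - 1) • radialKernel d s t)
      (fun t => t⁻¹ * (t / (1 + t) ^ 2) ^ s) (Set.Ioi 0) :=
    fun t ht => pow_mul_radialKernel Module.finrank_pos.ne' s ht
  have hint : Integrable (fun x => radialKernel d s ‖x‖) μ :=
    (integrable_fun_norm_addHaar μ).2
      ((integrableOn_Ioi_inv_mul_rpow hs).congr_fun hradial.symm measurableSet_Ioi)
  rw [lintegral_sub_right_eq_self (fun x => ENNReal.ofReal (radialKernel d s ‖x‖)) p,
    ← ofReal_integral_eq_lintegral_ofReal hint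
      (ae_of_all _ fun x => radialKernel_nonneg d s (norm_nonneg x))]
  refine ENNReal.ofReal_le_ofReal ?_
  rw [integral_fun_norm_addHaar μ (radialKernel d s),
    setIntegral_congr_fun measurableSet_Ioi hradial, nsmul_eq_mul, smul_eq_mul, ← mul_assoc,
    mul_div_assoc]
  exact mul_le_mul_of_nonneg_left (integral_Ioi_inv_mul_rpow_le hs) (by positivity)

namespace PoleData

/-- `R ≥ 1` bounds the poles, the coefficients of the height and the inverse distances between
the poles. -/
structure IsBound (P : PoleData N n) (R : ℝ) : Prop where
  one_le : 1 ≤ R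
  norm_pole : ∀ i, ‖P.pole i‖ ≤ R
  curv : |P.curv| ≤ R
  lin : ‖P.lin‖ ≤ R
  cst : |P.cst| ≤ R
  dist : ∀ i j, i ≠ j → 1 ≤ R * ‖P.pole i - P.pole j‖

lemma exists_isBound (P : PoleData N n) : ∃ R : ℝ, P.IsBound R := by
  have hdist : ∀ᶠ R : ℝ in atTop, ∀ i j, i ≠ j → 1 ≤ R * ‖P.pole i - P.pole j‖ := by
    simp only [eventually_all]
    intro i j hij
    have hpos : 0 < ‖P.pole i - P.pole j‖ := norm_pos_iff.2 (sub_ne_zero.2 (P.injective.ne hij))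
    filter_upwards [eventually_ge_atTop ‖P.pole i - P.pole j‖⁻¹] with R hR
    exact (inv_le_iff_one_le_mul₀ hpos).1 hR
  obtain ⟨R, hone, hpole, hcurv, hlin, hcst, hR⟩ := ((eventually_ge_atTop (1 : ℝ)).and
    ((eventually_all.2 fun i => eventually_ge_atTop ‖P.pole i‖).and
      ((eventually_ge_atTop |P.curv|).and ((eventually_ge_atTop ‖P.lin‖).and
        ((eventually_ge_atTop |P.cst|).and hdist))))).exists
  exact ⟨R, hone, hpole, hcurv, hlin, hcst, hR⟩

/-- The function `h / (1 + |x|²)²`, which vanishes on the boundary and at infinity, and whose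
logarithm is used to build cut-off functions. -/
def decay (P : PoleData N n) (x : E N) : ℝ :=
  P.height x / (1 + ‖x‖ ^ 2) ^ 2

/-- The gradient of `log (h / (1 + |x|²)²)`. -/
def decayGrad (P : PoleData N n) (x : E N) : E N :=
  (P.height x)⁻¹ • P.heightGrad x - (4 / (1 + ‖x‖ ^ 2)) • x

/-- The pole `k` is one of the poles nearest to `x`. -/
def IsNearest (P : PoleData N n) (x : E N) (k : Fin n) : Prop :=
  ∀ j, ‖x - P.pole k‖ ≤ ‖x - P.pole j‖

variable {P : PoleData N n} {x : E N}

lemma exists_isNearest [NeZero n] (P : PoleData N n) (x : E N) : ∃ k, P.IsNearest x k :=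
  Finite.exists_min fun j => ‖x - P.pole j‖

lemma weight_sq (hx : x ∈ P.domain) :
    P.weight x ^ 2 = ∏ i, ‖x - P.pole i‖ ^ (-(2 * P.expo)) := by
  rw [weight, ← Real.exp_nat_mul, Finset.mul_sum, Finset.mul_sum, Real.exp_sum]
  refine Finset.prod_congr rfl fun i _ => ?_
  rw [Real.rpow_def_of_pos (norm_sub_pole_pos hx i), Real.log_pow]
  push_cast
  ring_nf

lemma one_add_norm_sq_le (x : E N) : (1 + ‖x‖) ^ 2 ≤ 2 * (1 + ‖x‖ ^ 2) := by
  linarith [add_sq_le (a := 1) (b := ‖x‖)]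

lemma decay_le_of_height_le {s : ℝ} (hs : 0 ≤ s) (h : P.height x ≤ s * (1 + ‖x‖) ^ 2) :
    P.decay x ≤ 4 * s / (1 + ‖x‖) ^ 2 := by
  rw [decay, div_le_div_iff₀ (by positivity) (by positivity)]
  calc P.height x * (1 + ‖x‖) ^ 2 ≤ s * (1 + ‖x‖) ^ 2 * (1 + ‖x‖) ^ 2 := by gcongr
    _ ≤ s * (2 * (1 + ‖x‖ ^ 2)) * (2 * (1 + ‖x‖ ^ 2)) := by
      gcongr <;> exact one_add_norm_sq_le x
    _ = 4 * s * (1 + ‖x‖ ^ 2) ^ 2 := by ring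

namespace IsBound

variable {R : ℝ}

lemma pos (h : P.IsBound R) : 0 < R := zero_lt_one.trans_le h.one_le

lemma norm_sub_pole_le (h : P.IsBound R) (x : E N) (i : Fin n) :
    ‖x - P.pole i‖ ≤ R * (1 + ‖x‖) := by
  have := mul_le_mul_of_nonneg_right h.one_le (norm_nonneg x)
  linarith [norm_sub_le x (P.pole i), h.norm_pole i]

lemma one_add_norm_sub_pole_le (h : P.IsBound R) (x : E N) (i : Fin n) :
    1 + ‖x - P.pole i‖ ≤ 2 * R * (1 + ‖x‖) := by
  have := mul_le_mul_of_nonneg_right h.one_le (norm_nonneg x)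
  linarith [h.norm_sub_pole_le x i, norm_nonneg x, h.one_le]

lemma norm_heightGrad_le (h : P.IsBound R) (x : E N) :
    ‖P.heightGrad x‖ ≤ 2 * R * (1 + ‖x‖) := by
  have hadd := norm_add_le ((2 * P.curv) • x) P.lin
  rw [norm_smul, Real.norm_eq_abs, abs_mul, abs_of_pos (two_pos : (0 : ℝ) < 2)] at hadd
  have hcurv := mul_le_mul_of_nonneg_right h.curv (norm_nonneg x)
  rw [heightGrad]
  linarith [h.pos, h.lin]

lemma height_le (h : P.IsBound R) (x : E N) : P.height x ≤ R * (1 + ‖x‖) ^ 2 := by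
  have hcurv := mul_le_mul_of_nonneg_right (abs_le.1 h.curv).2 (sq_nonneg ‖x‖)
  have hlin := (real_inner_le_norm P.lin x).trans
    (mul_le_mul_of_nonneg_right h.lin (norm_nonneg x))
  have hcst := (abs_le.1 h.cst).2
  have hR := mul_nonneg h.pos.le (norm_nonneg x)
  rw [height]
  linarith

lemma height_le_mul (h : P.IsBound R) (x : E N) (i : Fin n) :
    P.height x ≤ 3 * R ^ 2 * (1 + ‖x‖) * ‖x - P.pole i‖ := by
  have hR := h.one_le
  have hcurv := (neg_le_abs P.curv).trans h.curv
  calc P.height x = inner ℝ (P.heightGrad x) (x - P.pole i) +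
        -P.curv * (‖x - P.pole i‖ * ‖x - P.pole i‖) := by
        rw [inner_heightGrad_sub_pole]
        ring
    _ ≤ 2 * R * (1 + ‖x‖) * ‖x - P.pole i‖ + R * (R * (1 + ‖x‖) * ‖x - P.pole i‖) := by
        gcongr
        · exact (real_inner_le_norm _ _).trans (by gcongr; exact h.norm_heightGrad_le x)
        · exact h.norm_sub_pole_le x i
    _ ≤ 2 * R ^ 2 * (1 + ‖x‖) * ‖x - P.pole i‖ + R * (R * (1 + ‖x‖) * ‖x - P.pole i‖) := by
        gcongr
        exact le_self_pow₀ hR two_ne_zero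
    _ = _ := by ring

lemma decay_le (h : P.IsBound R) (x : E N) : P.decay x ≤ 4 * R / (1 + ‖x‖) ^ 2 :=
  decay_le_of_height_le h.pos.le (h.height_le x)

lemma decay_le_mul_div (h : P.IsBound R) (x : E N) (k : Fin n) :
    P.decay x ≤ 48 * R ^ 4 * (‖x - P.pole k‖ / (1 + ‖x - P.pole k‖) ^ 2) := by
  have hheight : P.height x ≤ 3 * R ^ 2 * ‖x - P.pole k‖ * (1 + ‖x‖) ^ 2 := by
    refine (h.height_le_mul x k).trans ?_
    rw [mul_right_comm]
    gcongr
    exact le_self_pow₀ (by linarith [norm_nonneg x]) two_ne_zero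
  refine (decay_le_of_height_le (by positivity) hheight).trans ?_
  rw [mul_div_assoc', div_le_div_iff₀ (by positivity) (by positivity)]
  calc 4 * (3 * R ^ 2 * ‖x - P.pole k‖) * (1 + ‖x - P.pole k‖) ^ 2
      ≤ 4 * (3 * R ^ 2 * ‖x - P.pole k‖) * (2 * R * (1 + ‖x‖)) ^ 2 := by
        gcongr
        exact h.one_add_norm_sub_pole_le x k
    _ = _ := by ring

lemma one_add_norm_le (h : P.IsBound R) {j k : Fin n} (hk : P.IsNearest x k) (hj : j ≠ k) :
    1 + ‖x‖ ≤ 5 * R ^ 2 * ‖x - P.pole j‖ := by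
  have hsep : ‖P.pole j - P.pole k‖ ≤ 2 * ‖x - P.pole j‖ := by
    have htri := norm_sub_le (x - P.pole k) (x - P.pole j)
    rw [sub_sub_sub_cancel_left] at htri
    linarith [hk j]
  have hone : 1 ≤ 2 * R * ‖x - P.pole j‖ := by
    linarith [(h.dist j k hj).trans (mul_le_mul_of_nonneg_left hsep h.pos.le)]
  have hnorm : ‖x‖ ≤ ‖x - P.pole j‖ + R := by
    have htri := norm_add_le (x - P.pole j) (P.pole j)
    rw [sub_add_cancel] at htri
    linarith [h.norm_pole j]
  calc 1 + ‖x‖ ≤ 1 * ‖x - P.pole j‖ + 2 * R * 1 := by linarith [h.one_le]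
    _ ≤ R ^ 2 * ‖x - P.pole j‖ + 2 * R * (2 * R * ‖x - P.pole j‖) := by
      have := h.pos
      gcongr
      exact one_le_pow₀ h.one_le
    _ = _ := by ring

lemma height_le_mul_mul (h : P.IsBound R) {i j k : Fin n} (hk : P.IsNearest x k) (hij : i ≠ j) :
    P.height x ≤ 15 * R ^ 4 * (‖x - P.pole i‖ * ‖x - P.pole j‖) := by
  wlog hi : i ≠ k generalizing i j
  · rw [mul_comm ‖x - P.pole i‖]
    exact this hij.symm fun hj => hij (by rw [hj, not_ne_iff.1 hi])
  calc P.height x ≤ 3 * R ^ 2 * (1 + ‖x‖) * ‖x - P.pole j‖ := h.height_le_mul x j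
    _ ≤ 3 * R ^ 2 * (5 * R ^ 2 * ‖x - P.pole i‖) * ‖x - P.pole j‖ := by
      gcongr
      exact h.one_add_norm_le hk hi
    _ = _ := by ring

lemma potential_mul_height_sq_le (h : P.IsBound R) (hx : x ∈ P.domain) {k : Fin n}
    (hk : P.IsNearest x k) :
    potential P.pole x * P.height x ^ 2 ≤ n * (n * ((2 * R) ^ 2 * (15 * R ^ 4) ^ 2)) := by
  have hterm : ∀ i j, i ≠ j → ‖P.pole i - P.pole j‖ ^ 2 /
      (‖x - P.pole i‖ ^ 2 * ‖x - P.pole j‖ ^ 2) * P.height x ^ 2 ≤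
      (2 * R) ^ 2 * (15 * R ^ 4) ^ 2 := by
    intro i j hij
    have hi := norm_sub_pole_pos hx i
    have hj := norm_sub_pole_pos hx j
    have hpoles : ‖P.pole i - P.pole j‖ ≤ 2 * R :=
      (norm_sub_le _ _).trans (by linarith [h.norm_pole i, h.norm_pole j])
    have hheight := h.height_le_mul_mul hk hij
    have hh := (mem_domain.1 hx).le
    rw [← mul_pow, div_mul_eq_mul_div, div_le_iff₀ (by positivity), mul_assoc,
      ← mul_pow (15 * R ^ 4)]
    gcongr
  calc potential P.pole x * P.height x ^ 2
      ≤ ∑ i : Fin n, ∑ j ∈ Finset.Ioi i, (2 * R) ^ 2 * (15 * R ^ 4) ^ 2 := by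
        simp only [potential, Finset.sum_mul]
        exact Finset.sum_le_sum fun i _ => Finset.sum_le_sum fun j hj =>
          hterm i j (Finset.mem_Ioi.1 hj).ne
    _ ≤ ∑ _i : Fin n, ∑ _j : Fin n, (2 * R) ^ 2 * (15 * R ^ 4) ^ 2 :=
        Finset.sum_le_sum fun i _ => Finset.sum_le_sum_of_subset_of_nonneg
          (Finset.subset_univ _) fun _ _ _ => by positivity
    _ = _ := by simp only [Finset.sum_const, Finset.card_univ, Fintype.card_fin, nsmul_eq_mul]

lemma norm_height_smul_decayGrad_le (h : P.IsBound R) (hx : x ∈ P.domain) :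
    ‖P.height x • P.decayGrad x‖ ≤ 10 * R * (1 + ‖x‖) := by
  have hh := mem_domain.1 hx
  have hcoef : P.height x * (4 / (1 + ‖x‖ ^ 2)) ≤ 8 * R := by
    rw [← mul_div_assoc, div_le_iff₀ (by positivity)]
    have := mul_le_mul_of_nonneg_left (one_add_norm_sq_le x) h.pos.le
    linarith [h.height_le x]
  rw [decayGrad, smul_sub, smul_smul, smul_smul, mul_inv_cancel₀ hh.ne', one_smul]
  calc _ ≤ ‖P.heightGrad x‖ + P.height x * (4 / (1 + ‖x‖ ^ 2)) * ‖x‖ := by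
        refine (norm_sub_le _ _).trans_eq ?_
        rw [norm_smul, Real.norm_of_nonneg (by positivity)]
    _ ≤ 2 * R * (1 + ‖x‖) + 8 * R * ‖x‖ := by
        gcongr
        exact h.norm_heightGrad_le x
    _ ≤ _ := by linarith [h.pos]

lemma groundState_sq_mul_norm_decayGrad_sq_le (h : P.IsBound R) (hx : x ∈ P.domain) :
    P.groundState x ^ 2 * ‖P.decayGrad x‖ ^ 2 ≤
      (10 * R) ^ 2 * (P.weight x ^ 2 * (1 + ‖x‖) ^ 2) := by
  calc P.groundState x ^ 2 * ‖P.decayGrad x‖ ^ 2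
      = P.weight x ^ 2 * ‖P.height x • P.decayGrad x‖ ^ 2 := by
        rw [norm_smul, groundState, mul_pow, mul_pow, Real.norm_eq_abs, sq_abs]
        ring
    _ ≤ P.weight x ^ 2 * (10 * R * (1 + ‖x‖)) ^ 2 := by
        gcongr
        exact h.norm_height_smul_decayGrad_le hx
    _ = _ := by ring

lemma weight_sq_le (h : P.IsBound R) (hx : x ∈ P.domain) {k : Fin n} (hk : P.IsNearest x k) :
    P.weight x ^ 2 ≤ ‖x - P.pole k‖ ^ (-(2 * P.expo)) *
      ((1 + ‖x‖) / (5 * R ^ 2)) ^ (-(2 * N - 2 * P.expo)) := by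
  have hn : n ≠ 0 := k.pos.ne'
  have hR := h.pos
  have hsep : ∀ j ∈ Finset.univ.erase k, ‖x - P.pole j‖ ^ (-(2 * P.expo)) ≤
      ((1 + ‖x‖) / (5 * R ^ 2)) ^ (-(2 * P.expo)) := fun j hj => by
    refine Real.rpow_le_rpow_of_nonpos (by positivity) ?_ (by linarith [P.expo_nonneg])
    exact (div_le_iff₀' (by positivity)).2 (h.one_add_norm_le hk (Finset.ne_of_mem_erase hj))
  rw [weight_sq hx, ← Finset.mul_prod_erase _ _ (Finset.mem_univ k)]
  gcongr
  refine (Finset.prod_le_prod (fun j _ => by positivity) hsep).trans_eq ?_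
  rw [Finset.prod_const, Finset.card_erase_of_mem (Finset.mem_univ k), Finset.card_univ,
    Fintype.card_fin, ← Real.rpow_mul_natCast (by positivity), Nat.cast_sub k.pos, ← P.expo_mul hn]
  congr 1
  push_cast
  ring

lemma weight_sq_mul_le (h : P.IsBound R) (hN : 2 ≤ N) (hn : 2 ≤ n) (hx : x ∈ P.domain)
    {k : Fin n} (hk : P.IsNearest x k) : P.weight x ^ 2 * (1 + ‖x‖) ^ 2 ≤
      (5 * R ^ 2) ^ (2 * N - 2 * P.expo) * R ^ (N - 2 * P.expo) *
        ‖x - P.pole k‖ ^ (-(N : ℝ)) := by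
  have hR := h.pos
  have hN' : (2 : ℝ) ≤ N := by exact_mod_cast hN
  have hβ := P.two_mul_expo_le hn
  set d := ‖x - P.pole k‖
  have hd0 : 0 < d := norm_sub_pole_pos hx k
  set m := 1 + ‖x‖
  have hm1 : 1 ≤ m := le_add_of_nonneg_right (norm_nonneg x)
  have hm0 : 0 < m := by positivity
  calc P.weight x ^ 2 * m ^ 2
      ≤ d ^ (-(2 * P.expo)) * (m / (5 * R ^ 2)) ^ (-(2 * N - 2 * P.expo)) * m ^ 2 := by
        gcongr
        exact h.weight_sq_le hx hk
    _ = d ^ (N - 2 * P.expo) * ((5 * R ^ 2) ^ (2 * N - 2 * P.expo) *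
          m ^ (2 - 2 * N + 2 * P.expo)) * d ^ (-(N : ℝ)) := by
        rw [Real.div_rpow hm0.le (by positivity), Real.rpow_neg (x := 5 * R ^ 2) (by positivity),
          div_inv_eq_mul, show -(2 * P.expo) = N - 2 * P.expo + -N by ring, Real.rpow_add hd0,
          show 2 - 2 * N + 2 * P.expo = -(2 * N - 2 * P.expo) + 2 by ring, Real.rpow_add hm0,
          Real.rpow_two]
        ring
    _ ≤ (R * m) ^ (N - 2 * P.expo) * ((5 * R ^ 2) ^ (2 * N - 2 * P.expo) *
          m ^ (2 - 2 * N + 2 * P.expo)) * d ^ (-(N : ℝ)) := by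
        gcongr ?_ * _ * _
        exact Real.rpow_le_rpow hd0.le (h.norm_sub_pole_le x k) (by linarith)
    _ = (5 * R ^ 2) ^ (2 * N - 2 * P.expo) * R ^ (N - 2 * P.expo) * d ^ (-(N : ℝ)) *
          m ^ (2 - N : ℝ) := by
        have hadd : m ^ (2 - N : ℝ) = m ^ (N - 2 * P.expo) * m ^ (2 - 2 * N + 2 * P.expo) := by
          rw [← Real.rpow_add hm0]
          ring_nf
        rw [Real.mul_rpow hR.le hm0.le, hadd]
        ring
    _ ≤ _ := mul_le_of_le_one_right (by positivity)
        (Real.rpow_le_one_of_one_le_of_nonpos hm1 (by linarith))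

lemma weight_sq_le_radialKernel (h : P.IsBound R) (hn : 2 ≤ n) (hx : x ∈ P.domain) {k : Fin n}
    (hk : P.IsNearest x k) : P.weight x ^ 2 ≤
      (5 * R ^ 2) ^ (2 * N - 2 * P.expo) * ((2 * R) ^ 2) ^ (N - 2 * P.expo) *
        radialKernel N (N - 2 * P.expo) ‖x - P.pole k‖ := by
  have hR := h.pos
  have hβ := P.two_mul_expo_le hn
  have hβ0 := P.expo_nonneg
  set s := N - 2 * P.expo
  set d := ‖x - P.pole k‖
  have hd0 : 0 < d := norm_sub_pole_pos hx k
  set m := 1 + ‖x‖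
  have hm1 : 1 ≤ m := le_add_of_nonneg_right (norm_nonneg x)
  have hm0 : 0 < m := by positivity
  have hdecay : m ^ (-(2 * N - 2 * P.expo)) ≤ (((1 + d) / (2 * R)) ^ 2) ^ (-s) := by
    calc m ^ (-(2 * N - 2 * P.expo)) ≤ m ^ (2 * -s) :=
          Real.rpow_le_rpow_of_exponent_le hm1 (by linarith)
      _ = (m ^ 2) ^ (-s) := by rw [Real.rpow_mul hm0.le, Real.rpow_two]
      _ ≤ _ := Real.rpow_le_rpow_of_nonpos (by positivity)
          (by gcongr; exact (div_le_iff₀' (by positivity)).2 (h.one_add_norm_sub_pole_le x k))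
          (by linarith)
  calc P.weight x ^ 2
      ≤ d ^ (-(2 * P.expo)) * (m / (5 * R ^ 2)) ^ (-(2 * N - 2 * P.expo)) := h.weight_sq_le hx hk
    _ = d ^ (-(2 * P.expo)) * ((5 * R ^ 2) ^ (2 * N - 2 * P.expo) *
          m ^ (-(2 * N - 2 * P.expo))) := by
        rw [Real.div_rpow hm0.le (by positivity), Real.rpow_neg (x := 5 * R ^ 2) (by positivity),
          div_inv_eq_mul, mul_comm (m ^ _)]
    _ ≤ d ^ (-(2 * P.expo)) * ((5 * R ^ 2) ^ (2 * N - 2 * P.expo) *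
          (((1 + d) / (2 * R)) ^ 2) ^ (-s)) := by gcongr
    _ = _ := by
        rw [radialKernel, div_pow, Real.div_rpow (by positivity) (by positivity),
          Real.div_rpow hd0.le (by positivity), Real.rpow_neg (x := (1 + d) ^ 2) (by positivity),
          Real.rpow_neg (x := (2 * R) ^ 2) (by positivity), div_inv_eq_mul,
          show -(2 * P.expo) = -N + s by ring, Real.rpow_add hd0]
        ring

end IsBound

lemma exists_groundState_sq_mul_norm_decayGrad_sq_le (hN : 2 ≤ N) (hn : 2 ≤ n)
    (P : PoleData N n) : ∃ C : ℝ, 0 ≤ C ∧ ∀ x ∈ P.domain, ∀ k, P.IsNearest x k →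
      P.groundState x ^ 2 * ‖P.decayGrad x‖ ^ 2 ≤ C * ‖x - P.pole k‖ ^ (-(N : ℝ)) := by
  obtain ⟨R, h⟩ := P.exists_isBound
  have hR := h.pos
  refine ⟨(10 * R) ^ 2 * ((5 * R ^ 2) ^ (2 * N - 2 * P.expo) * R ^ (N - 2 * P.expo)),
    by positivity, fun x hx k hk => (h.groundState_sq_mul_norm_decayGrad_sq_le hx).trans ?_⟩
  rw [mul_assoc ((10 * R) ^ 2)]
  gcongr ?_ * ?_
  exact h.weight_sq_mul_le hN hn hx hk

lemma exists_potential_mul_groundState_sq_le (hn : 2 ≤ n) (P : PoleData N n) :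
    ∃ C : ℝ, 0 ≤ C ∧ ∀ x ∈ P.domain, ∀ k, P.IsNearest x k →
      potential P.pole x * P.groundState x ^ 2 ≤
        C * radialKernel N (N - 2 * P.expo) ‖x - P.pole k‖ := by
  obtain ⟨R, h⟩ := P.exists_isBound
  have hR := h.pos
  refine ⟨n * (n * ((2 * R) ^ 2 * (15 * R ^ 4) ^ 2)) *
    ((5 * R ^ 2) ^ (2 * N - 2 * P.expo) * ((2 * R) ^ 2) ^ (N - 2 * P.expo)),
    by positivity, fun x hx k hk => ?_⟩
  rw [groundState, mul_pow, ← mul_assoc, mul_assoc _ (_ * _) (radialKernel _ _ _)]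
  exact mul_le_mul (h.potential_mul_height_sq_le hx hk) (h.weight_sq_le_radialKernel hn hx hk)
    (sq_nonneg _) (by positivity)

end PoleData

lemma deriv_smoothTransition_of_notMem_Icc {s : ℝ} (hs : s ∉ Set.Icc 0 1) :
    deriv Real.smoothTransition s = 0 := by
  rw [Set.mem_Icc, not_and_or, not_le, not_le] at hs
  rcases hs with h0 | h1
  · have h : Real.smoothTransition =ᶠ[𝓝 s] fun _ => 0 := by
      filter_upwards [Iio_mem_nhds h0] with t ht using Real.smoothTransition.zero_of_nonpos ht.le
    rw [h.deriv_eq, deriv_const]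
  · have h : Real.smoothTransition =ᶠ[𝓝 s] fun _ => 1 := by
      filter_upwards [Ioi_mem_nhds h1] with t ht using Real.smoothTransition.one_of_one_le ht.le
    rw [h.deriv_eq, deriv_const]

lemma exists_norm_deriv_smoothTransition_le :
    ∃ M : ℝ, ∀ s, ‖deriv Real.smoothTransition s‖ ≤ M :=
  (HasCompactSupport.intro isCompact_Icc fun _ hs =>
    deriv_smoothTransition_of_notMem_Icc hs).exists_bound_of_continuous
      ((Real.smoothTransition.contDiff (n := 1)).continuous_deriv le_rfl)

namespace PoleData

section Cutoff

variable {P : PoleData N n} {x : E N} {ε : ℝ}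

lemma decay_pos (hx : x ∈ P.domain) : 0 < P.decay x :=
  div_pos hx (by positivity)

lemma mem_domain_of_decay_pos (hx : 0 < P.decay x) : x ∈ P.domain :=
  (div_pos_iff_of_pos_right (by positivity)).1 hx

lemma contDiff_decay {m : WithTop ℕ∞} (P : PoleData N n) : ContDiff ℝ m P.decay :=
  P.contDiff_height.div ((contDiff_const.add (contDiff_norm_sq ℝ)).pow 2) fun x => by positivity

lemma hasGradientAt_log_decay (hx : x ∈ P.domain) :
    HasGradientAt (fun y => Real.log (P.decay y)) (P.decayGrad x) x := by
  have hnorm : HasGradientAt (fun y : E N => ‖y‖ ^ 2) ((2 : ℝ) • x) x := by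
    simpa using hasGradientAt_norm_sub_sq (0 : E N) x
  have hlog : HasDerivAt (fun t : ℝ => -2 * Real.log (1 + t)) (-2 * (1 / (1 + ‖x‖ ^ 2)))
      (‖x‖ ^ 2) :=
    (((hasDerivAt_id' (‖x‖ ^ 2)).const_add 1).log (by positivity)).const_mul (-2)
  have hsum := hasGradientAt_add (hasGradientAt_comp (Real.hasDerivAt_log (mem_domain.1 hx).ne')
    (P.hasGradientAt_height x)) (hasGradientAt_comp hlog hnorm)
  have hgrad : P.decayGrad x =
      (P.height x)⁻¹ • P.heightGrad x + (-2 * (1 / (1 + ‖x‖ ^ 2))) • (2 : ℝ) • x := by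
    rw [decayGrad, smul_smul, sub_eq_add_neg, ← neg_smul]
    ring_nf
  rw [hgrad]
  refine HasFDerivAt.congr_of_eventuallyEq hsum ?_
  filter_upwards [P.domain.isOpen.mem_nhds hx] with y hy
  rw [decay, Real.log_div (mem_domain.1 hy).ne' (by positivity), Real.log_pow]
  push_cast
  ring

lemma isCompact_le_decay {s : ℝ} (hs : 0 < s) (P : PoleData N n) :
    IsCompact {x | s ≤ P.decay x} := by
  obtain ⟨R, hR⟩ := P.exists_isBound
  refine Metric.isCompact_of_isClosed_isBounded
    (isClosed_le continuous_const (P.contDiff_decay (m := 0)).continuous)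
    ((Metric.isBounded_closedBall (x := 0) (r := 4 * R / s)).subset fun x hx => ?_)
  rw [mem_closedBall_zero_iff, le_div_iff₀' hs]
  have hle := (le_div_iff₀ (by positivity)).1 (hx.out.trans (hR.decay_le x))
  have hnorm : ‖x‖ ≤ (1 + ‖x‖) ^ 2 := by nlinarith [norm_nonneg x]
  exact (mul_le_mul_of_nonneg_left hnorm hs.le).trans hle

/-- The logarithmic cut-off function: it vanishes where `decay ≤ exp (-2 / ε)`, and equals `1` where
`decay ≥ exp (-1 / ε)`. -/
def cutoff (P : PoleData N n) (ε : ℝ) (x : E N) : ℝ :=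
  Real.smoothTransition (ε * Real.log (P.decay x) + 2)

/-- The derivative of the cut-off function with respect to `log decay`. -/
def cutoffDeriv (P : PoleData N n) (ε : ℝ) (x : E N) : ℝ :=
  deriv Real.smoothTransition (ε * Real.log (P.decay x) + 2) * ε

lemma contDiffOn_cutoff {m : ℕ∞} (P : PoleData N n) (ε : ℝ) :
    ContDiffOn ℝ m (P.cutoff ε) P.domain :=
  Real.smoothTransition.contDiff.comp_contDiffOn ((contDiffOn_const.mul
    (P.contDiff_decay.contDiffOn.log fun _ hx => (decay_pos hx).ne')).add contDiffOn_const)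

lemma hasGradientAt_cutoff (hx : x ∈ P.domain) (ε : ℝ) :
    HasGradientAt (P.cutoff ε) (P.cutoffDeriv ε x • P.decayGrad x) x := by
  have haffine : HasDerivAt (fun s : ℝ => ε * s + 2) ε (Real.log (P.decay x)) := by
    simpa using ((hasDerivAt_id (Real.log (P.decay x))).const_mul ε).add_const 2
  exact hasGradientAt_comp (f := fun s : ℝ => Real.smoothTransition (ε * s + 2))
    (((Real.smoothTransition.contDiff (n := 1)).differentiable one_ne_zero _).hasDerivAt.comp _
      haffine) (hasGradientAt_log_decay hx)

lemma cutoff_eq_zero (hε : 0 < ε) (hx : x ∈ P.domain) (h : P.decay x < Real.exp (-2 / ε)) :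
    P.cutoff ε x = 0 := by
  have hlog := (lt_div_iff₀' hε).1 ((Real.log_lt_iff_lt_exp (decay_pos hx)).2 h)
  exact Real.smoothTransition.zero_of_nonpos (by linarith)

/-- The ground state multiplied by the logarithmic cut-off function, as a test function. -/
def truncation (P : PoleData N n) (hε : 0 < ε) : TestFunction P.domain ℝ ⊤ :=
  testFunctionOf P.domain
    (Set.indicator P.domain fun x => P.cutoff ε x * P.groundState x)
    (((P.contDiffOn_cutoff ε).mul P.contDiffOn_groundState).congr
      fun _ hx => Set.indicator_of_mem hx _)
    {x | Real.exp (-2 / ε) ≤ P.decay x} (P.isCompact_le_decay (Real.exp_pos _))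
    (fun _ hx => mem_domain_of_decay_pos ((Real.exp_pos _).trans_le hx))
    fun x hx => Set.indicator_apply_eq_zero.2 fun hxΩ => by
      rw [cutoff_eq_zero hε hxΩ (not_le.1 hx), zero_mul]

lemma truncation_apply (hε : 0 < ε) (hx : x ∈ P.domain) :
    P.truncation hε x = P.cutoff ε x * P.groundState x :=
  Set.indicator_of_mem hx fun x => P.cutoff ε x * P.groundState x

lemma truncation_nonneg (hε : 0 < ε) (hx : x ∈ P.domain) : 0 ≤ P.truncation hε x := by
  rw [truncation_apply hε hx]
  exact mul_nonneg (Real.smoothTransition.nonneg _) (groundState_pos hx).le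

lemma truncation_le_groundState (hε : 0 < ε) (hx : x ∈ P.domain) :
    P.truncation hε x ≤ P.groundState x := by
  rw [truncation_apply hε hx]
  exact mul_le_of_le_one_left (groundState_pos hx).le (Real.smoothTransition.le_one _)

lemma gradient_truncation_sub (hε : 0 < ε) (hx : x ∈ P.domain) :
    gradient (P.truncation hε) x - P.truncation hε x • P.logGrad x =
      (P.groundState x * P.cutoffDeriv ε x) • P.decayGrad x := by
  have hmul := hasGradientAt_mul (hasGradientAt_cutoff hx ε) (hasGradientAt_groundState hx)
  have hgrad : HasGradientAt (P.truncation hε) _ x := HasFDerivAt.congr_of_eventuallyEq hmul (by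
    filter_upwards [P.domain.isOpen.mem_nhds hx] with y hy using truncation_apply hε hy)
  rw [hgrad.gradient, truncation_apply hε hx, smul_smul, smul_smul, add_sub_cancel_left]

end Cutoff

section Remainder

variable {P : PoleData N n} {x : E N} {ε : ℝ}

lemma exists_setLIntegral_le (hN : N ≠ 0) (P : PoleData N n) :
    ∃ C : ℝ, ∀ s, 0 < s → ∀ c, 0 ≤ c → ∀ f : E N → ℝ,
      (∀ x ∈ P.domain, ∃ k, f x ≤ c * radialKernel N s ‖x - P.pole k‖) →
      ∫⁻ x in P.domain, ENNReal.ofReal (f x) ≤ ENNReal.ofReal (c * (C / s)) := by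
  have : NeZero N := ⟨hN⟩
  obtain ⟨C, hC⟩ := exists_lintegral_radialKernel_le (volume : Measure (E N))
  rw [finrank_euclideanSpace_fin] at hC
  refine ⟨n * C, fun s hs c hc f hf => ?_⟩
  calc ∫⁻ x in P.domain, ENNReal.ofReal (f x)
      ≤ ∫⁻ x in P.domain,
          ENNReal.ofReal c * ∑ i, ENNReal.ofReal (radialKernel N s ‖x - P.pole i‖) := by
        refine setLIntegral_mono' P.domain.isOpen.measurableSet fun x hx => ?_
        obtain ⟨k, hk⟩ := hf x hx
        refine (ENNReal.ofReal_le_ofReal hk).trans ?_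
        rw [ENNReal.ofReal_mul hc]
        gcongr
        exact Finset.single_le_sum (f := fun i => ENNReal.ofReal (radialKernel N s ‖x - P.pole i‖))
          (fun _ _ => zero_le) (Finset.mem_univ k)
    _ ≤ ∫⁻ x, ENNReal.ofReal c * ∑ i, ENNReal.ofReal (radialKernel N s ‖x - P.pole i‖) :=
        setLIntegral_le_lintegral _ _
    _ = ENNReal.ofReal c * ∑ i, ∫⁻ x, ENNReal.ofReal (radialKernel N s ‖x - P.pole i‖) := by
        rw [lintegral_const_mul' _ _ ENNReal.ofReal_ne_top, lintegral_finsetSum]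
        exact fun i _ => ((measurable_radialKernel N s).comp (by fun_prop)).ennreal_ofReal
    _ ≤ ENNReal.ofReal c * ∑ _i : Fin n, ENNReal.ofReal (C / s) := by
        gcongr
        exact hC s hs _
    _ = _ := by
        rw [Finset.sum_const, Finset.card_univ, Fintype.card_fin, nsmul_eq_mul,
          ← ENNReal.ofReal_natCast, ← ENNReal.ofReal_mul (by positivity),
          ← ENNReal.ofReal_mul hc, mul_div_assoc]

lemma sq_cutoffDeriv_le {M : ℝ} (hM : ∀ s, ‖deriv Real.smoothTransition s‖ ≤ M)
    (hx : x ∈ P.domain) (ε : ℝ) :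
    P.cutoffDeriv ε x ^ 2 ≤ ε ^ 2 * (M ^ 2 * (Real.exp 4 * P.decay x ^ (2 * ε))) := by
  rw [cutoffDeriv, mul_pow, mul_comm]
  gcongr
  by_cases hs : ε * Real.log (P.decay x) + 2 ∈ Set.Icc 0 1
  · have hone : 1 ≤ Real.exp 4 * P.decay x ^ (2 * ε) := by
      rw [Real.rpow_def_of_pos (decay_pos hx), ← Real.exp_add]
      exact Real.one_le_exp (by linarith [hs.1])
    calc deriv Real.smoothTransition (ε * Real.log (P.decay x) + 2) ^ 2 ≤ M ^ 2 * 1 := by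
          rw [mul_one, ← sq_abs, ← Real.norm_eq_abs]
          gcongr
          exact hM _
      _ ≤ _ := by gcongr
  · rw [deriv_smoothTransition_of_notMem_Icc hs, zero_pow two_ne_zero]
    have := decay_pos hx
    positivity

lemma exists_sq_norm_gradient_truncation_sub_le (hN : 2 ≤ N) (hn : 2 ≤ n) (P : PoleData N n) :
    ∃ C : ℝ, 0 ≤ C ∧ ∀ {ε} (hε : 0 < ε), ε ≤ 1 → ∀ x ∈ P.domain, ∃ k,
      ‖gradient (P.truncation hε) x - P.truncation hε x • P.logGrad x‖ ^ 2 ≤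
        ε ^ 2 * C * radialKernel N (2 * ε) ‖x - P.pole k‖ := by
  have : NeZero n := ⟨by lia⟩
  obtain ⟨C, hC0, hC⟩ := exists_groundState_sq_mul_norm_decayGrad_sq_le hN hn P
  obtain ⟨R, hR⟩ := P.exists_isBound
  obtain ⟨M, hM⟩ := exists_norm_deriv_smoothTransition_le
  refine ⟨M ^ 2 * Real.exp 4 * (48 * R ^ 4) ^ 2 * C, by positivity, fun {ε} hε hε1 x hx => ?_⟩
  obtain ⟨k, hk⟩ := P.exists_isNearest x
  refine ⟨k, ?_⟩
  set d := ‖x - P.pole k‖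
  have hR0 := hR.pos
  have hdecay : P.decay x ^ (2 * ε) ≤ (48 * R ^ 4) ^ 2 * (d / (1 + d) ^ 2) ^ (2 * ε) := by
    refine (Real.rpow_le_rpow (decay_pos hx).le (hR.decay_le_mul_div x k) (by positivity)).trans ?_
    rw [Real.mul_rpow (by positivity) (by positivity)]
    gcongr
    rw [← Real.rpow_two]
    exact Real.rpow_le_rpow_of_exponent_le (by linarith [one_le_pow₀ hR.one_le (n := 4)])
      (by linarith)
  calc ‖gradient (P.truncation hε) x - P.truncation hε x • P.logGrad x‖ ^ 2
      = P.cutoffDeriv ε x ^ 2 * (P.groundState x ^ 2 * ‖P.decayGrad x‖ ^ 2) := by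
        rw [gradient_truncation_sub hε hx, norm_smul, mul_pow, Real.norm_eq_abs, sq_abs]
        ring
    _ ≤ ε ^ 2 * (M ^ 2 * (Real.exp 4 * ((48 * R ^ 4) ^ 2 * (d / (1 + d) ^ 2) ^ (2 * ε)))) *
          (C * d ^ (-(N : ℝ))) := by
        gcongr ?_ * ?_
        · refine (sq_cutoffDeriv_le hM hx ε).trans ?_
          gcongr
        · exact hC x hx k hk
    _ = _ := by
        rw [radialKernel]
        ring

lemma exists_lintegral_remainder_truncation_le (hN : 2 ≤ N) (hn : 2 ≤ n) (P : PoleData N n) :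
    ∃ D : ℝ, ∀ {ε} (hε : 0 < ε), ε ≤ 1 →
      ∫⁻ x in P.domain, ENNReal.ofReal
        (‖gradient (P.truncation hε) x - P.truncation hε x • P.logGrad x‖ ^ 2) ≤
          ENNReal.ofReal (D * ε) := by
  obtain ⟨B, hB0, hB⟩ := exists_sq_norm_gradient_truncation_sub_le hN hn P
  obtain ⟨C, hC⟩ := P.exists_setLIntegral_le (by lia)
  refine ⟨B * C / 2, fun {ε} hε hε1 =>
    (hC (2 * ε) (by positivity) (ε ^ 2 * B) (by positivity) _ (hB hε hε1)).trans_eq ?_⟩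
  congr 1
  field_simp

/-- The sequence of truncations of the ground state with `ε = 1 / (k + 1)`. -/
def truncSeq (P : PoleData N n) (k : ℕ) : TestFunction P.domain ℝ ⊤ :=
  P.truncation (ε := 1 / ((k : ℝ) + 1)) Nat.one_div_pos_of_nat

lemma tendsto_truncSeq (hx : x ∈ P.domain) :
    Tendsto (fun k => P.truncSeq k x) atTop (𝓝 (P.groundState x)) := by
  have hlim : Tendsto (fun k : ℕ => P.cutoff (1 / ((k : ℝ) + 1)) x * P.groundState x) atTop
      (𝓝 (Real.smoothTransition (0 * Real.log (P.decay x) + 2) * P.groundState x)) :=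
    ((Real.smoothTransition.continuous.tendsto _).comp
      ((tendsto_one_div_add_atTop_nhds_zero_nat.mul_const _).add_const _)).mul_const _
  rw [Real.smoothTransition.one_of_one_le (by norm_num), one_mul] at hlim
  exact hlim.congr fun k => (truncation_apply _ hx).symm

lemma tendsto_gradient_truncSeq (hx : x ∈ P.domain) :
    Tendsto (fun k => gradient (P.truncSeq k) x) atTop (𝓝 (P.groundState x • P.logGrad x)) := by
  have hderiv : Tendsto (fun k : ℕ => P.cutoffDeriv (1 / ((k : ℝ) + 1)) x) atTop (𝓝 0) := by
    obtain ⟨M, hM⟩ := exists_norm_deriv_smoothTransition_le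
    exact isBoundedUnder_le_mul_tendsto_zero (isBoundedUnder_of ⟨M, fun _ => hM _⟩)
      tendsto_one_div_add_atTop_nhds_zero_nat
  have hrem : Tendsto (fun k => gradient (P.truncSeq k) x - P.truncSeq k x • P.logGrad x) atTop
      (𝓝 0) := by
    have hlim := (hderiv.const_mul (P.groundState x)).smul_const (P.decayGrad x)
    rw [mul_zero, zero_smul] at hlim
    exact hlim.congr fun k => (gradient_truncation_sub _ hx).symm
  simpa using hrem.add ((tendsto_truncSeq hx).smul_const (P.logGrad x))

lemma tendsto_lintegral_remainder_truncSeq (hN : 2 ≤ N) (hn : 2 ≤ n) (P : PoleData N n) :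
    Tendsto (fun k => ∫⁻ x in P.domain,
      ENNReal.ofReal (‖gradient (P.truncSeq k) x - P.truncSeq k x • P.logGrad x‖ ^ 2))
      atTop (𝓝 0) := by
  obtain ⟨D, hD⟩ := exists_lintegral_remainder_truncation_le hN hn P
  have hlim := ENNReal.tendsto_ofReal
    ((tendsto_one_div_add_atTop_nhds_zero_nat (𝕜 := ℝ)).const_mul D)
  rw [mul_zero, ENNReal.ofReal_zero] at hlim
  exact tendsto_of_tendsto_of_tendsto_of_le_of_le tendsto_const_nhds hlim (fun _ => zero_le)
    fun k => hD _ ((div_le_one (by positivity)).2 (by linarith [k.cast_nonneg (α := ℝ)]))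

end Remainder

end PoleData

namespace PoleData

variable {P : PoleData N n} {x : E N} {u : E N → ℝ} {G : E N → E N}

lemma div_le_potential (P : PoleData N n) (x : E N) {i j : Fin n} (hij : i < j) :
    ‖P.pole i - P.pole j‖ ^ 2 / (‖x - P.pole i‖ ^ 2 * ‖x - P.pole j‖ ^ 2) ≤
      potential P.pole x :=
  (Finset.single_le_sum (f := fun j => ‖P.pole i - P.pole j‖ ^ 2 /
    (‖x - P.pole i‖ ^ 2 * ‖x - P.pole j‖ ^ 2)) (fun _ _ => by positivity)
      (Finset.mem_Ioi.2 hij)).trans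
    (Finset.single_le_sum (f := fun i => ∑ j ∈ Finset.Ioi i, ‖P.pole i - P.pole j‖ ^ 2 /
      (‖x - P.pole i‖ ^ 2 * ‖x - P.pole j‖ ^ 2))
        (fun _ _ => Finset.sum_nonneg fun _ _ => by positivity) (Finset.mem_univ i))

lemma potential_pos (hn : 2 ≤ n) (hx : x ∈ P.domain) : 0 < potential P.pole x := by
  have hij : (⟨0, by lia⟩ : Fin n) < ⟨1, by lia⟩ := by simp
  refine lt_of_lt_of_le ?_ (P.div_le_potential x hij)
  have hsep := norm_pos_iff.2 (sub_ne_zero.2 (P.injective.ne hij.ne))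
  have hi := norm_sub_pole_pos hx ⟨0, by lia⟩
  have hj := norm_sub_pole_pos hx ⟨1, by lia⟩
  positivity

lemma aestronglyMeasurable_potential (P : PoleData N n) :
    AEStronglyMeasurable (potential P.pole) (volume.restrict P.domain) :=
  P.continuousOn_potential.aestronglyMeasurable P.domain.isOpen.measurableSet

lemma aestronglyMeasurable_logGrad (P : PoleData N n) :
    AEStronglyMeasurable P.logGrad (volume.restrict P.domain) :=
  (P.contDiffOn_logGrad (m := 0)).continuousOn.aestronglyMeasurable
    P.domain.isOpen.measurableSet

lemma aestronglyMeasurable_groundState (P : PoleData N n) :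
    AEStronglyMeasurable P.groundState (volume.restrict P.domain) :=
  (P.contDiffOn_groundState (m := 0)).continuousOn.aestronglyMeasurable
    P.domain.isOpen.measurableSet

lemma lintegral_remainder_add (hu : AEStronglyMeasurable u (volume.restrict P.domain))
    (hG : AEStronglyMeasurable G (volume.restrict P.domain)) :
    ∫⁻ x in P.domain, ENNReal.ofReal (‖G x - u x • P.logGrad x‖ ^ 2 +
        P.expo ^ 2 * potential P.pole x * u x ^ 2) =
      (∫⁻ x in P.domain, ENNReal.ofReal (‖G x - u x • P.logGrad x‖ ^ 2)) +
        ENNReal.ofReal (P.expo ^ 2) *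
          ∫⁻ x in P.domain, ENNReal.ofReal (potential P.pole x * u x ^ 2) := by
  rw [← lintegral_const_mul' _ _ ENNReal.ofReal_ne_top, ← lintegral_add_left']
  · refine lintegral_congr fun x => ?_
    have := potential_nonneg P.pole x
    rw [ENNReal.ofReal_add (by positivity) (by positivity), mul_assoc,
      ENNReal.ofReal_mul (p := P.expo ^ 2) (by positivity)]
  · exact ((hG.sub (hu.smul P.aestronglyMeasurable_logGrad)).norm.pow 2).aemeasurable.ennreal_ofReal

lemma lintegral_potential_ne_zero (hn : 2 ≤ n)
    (hu : AEStronglyMeasurable u (volume.restrict P.domain)) (hu0 : Nontrivial P.domain u) :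
    ∫⁻ x in P.domain, ENNReal.ofReal (potential P.pole x * u x ^ 2) ≠ 0 := by
  refine fun h0 => hu0 ?_
  rw [lintegral_eq_zero_iff'
    (P.aestronglyMeasurable_potential.fun_mul (hu.fun_pow 2)).aemeasurable.ennreal_ofReal] at h0
  filter_upwards [h0, ae_restrict_mem P.domain.isOpen.measurableSet] with x hx hxΩ
  have hle := ENNReal.ofReal_eq_zero.1 hx
  exact pow_eq_zero_iff two_ne_zero |>.1
    (le_antisymm (nonpos_of_mul_nonpos_right hle (potential_pos hn hxΩ)) (sq_nonneg _))

lemma lintegral_remainder_add_le (hn : n ≠ 0) (h : MemD12 P.domain u G) :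
    (∫⁻ x in P.domain, ENNReal.ofReal (‖G x - u x • P.logGrad x‖ ^ 2)) +
        ENNReal.ofReal (P.expo ^ 2) *
          ∫⁻ x in P.domain, ENNReal.ofReal (potential P.pole x * u x ^ 2) ≤
      ∫⁻ x in P.domain, ENNReal.ofReal (‖G x‖ ^ 2) := by
  rw [← lintegral_remainder_add h.aestronglyMeasurable h.memLp_grad.1]
  exact (P.isRiccatiField hn).lintegral_le_of_memD12 h

lemma le_hardyConstant (hn : 2 ≤ n) (P : PoleData N n) :
    ENNReal.ofReal (P.expo ^ 2) ≤ hardyConstant P.domain P.pole := by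
  refine le_sInf ?_
  rintro q ⟨u, G, hu, hu0, rfl⟩
  rw [quotient, ENNReal.le_div_iff_mul_le
    (Or.inl (lintegral_potential_ne_zero hn hu.aestronglyMeasurable hu0))
    (Or.inr hu.lintegral_gradient_ne_top)]
  exact le_add_self.trans (lintegral_remainder_add_le (by lia) hu)

lemma lintegral_gradient_testFunction (hn : n ≠ 0) (ψ : TestFunction P.domain ℝ ⊤) :
    ∫⁻ x in P.domain, ENNReal.ofReal (‖gradient ψ x‖ ^ 2) =
      (∫⁻ x in P.domain, ENNReal.ofReal (‖gradient ψ x - ψ x • P.logGrad x‖ ^ 2)) +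
        ENNReal.ofReal (P.expo ^ 2) *
          ∫⁻ x in P.domain, ENNReal.ofReal (potential P.pole x * ψ x ^ 2) := by
  rw [← lintegral_remainder_add ψ.continuous.aestronglyMeasurable
    (continuous_gradient_testFunction ψ).aestronglyMeasurable]
  exact (P.isRiccatiField hn).lintegral_gradient ψ

lemma quotient_testFunction_le (hn : n ≠ 0) (ψ : TestFunction P.domain ℝ ⊤) {b : ℝ≥0∞}
    (hb : b ≠ 0) (hb' : b ≠ ⊤)
    (hψ : b ≤ ∫⁻ x in P.domain, ENNReal.ofReal (potential P.pole x * ψ x ^ 2)) :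
    quotient P.domain P.pole ψ (gradient ψ) ≤ ENNReal.ofReal (P.expo ^ 2) +
      (∫⁻ x in P.domain, ENNReal.ofReal (‖gradient ψ x - ψ x • P.logGrad x‖ ^ 2)) / b := by
  refine ENNReal.div_le_of_le_mul ?_
  rw [lintegral_gradient_testFunction hn, add_mul, add_comm]
  gcongr
  calc _ = _ / b * b := (ENNReal.div_mul_cancel hb hb').symm
    _ ≤ _ := by gcongr

lemma nontrivial_of_lintegral_potential_ne_zero
    (h : ∫⁻ x in P.domain, ENNReal.ofReal (potential P.pole x * u x ^ 2) ≠ 0) :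
    Nontrivial P.domain u := fun hu => h <| lintegral_eq_zero_of_ae_eq_zero <| by
  filter_upwards [hu] with x hx
  simp [hx]

lemma nontrivial_groundState (hne : (P.domain : Set (E N)).Nonempty) :
    Nontrivial P.domain P.groundState := fun h => by
  have hfalse : ∀ᵐ _ ∂volume.restrict (P.domain : Set (E N)), False := by
    filter_upwards [h, ae_restrict_mem P.domain.isOpen.measurableSet] with x hx hxΩ
    exact (groundState_pos hxΩ).ne' hx
  rw [eventually_false_iff_eq_bot, ae_eq_bot, Measure.restrict_eq_zero] at hfalse
  exact (P.domain.isOpen.measure_pos volume hne).ne' hfalse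

lemma lintegral_potential_groundState_le_liminf (P : PoleData N n) :
    ∫⁻ x in P.domain, ENNReal.ofReal (potential P.pole x * P.groundState x ^ 2) ≤
      liminf (fun k => ∫⁻ x in P.domain,
        ENNReal.ofReal (potential P.pole x * P.truncSeq k x ^ 2)) atTop := by
  refine (lintegral_mono_ae ?_).trans (lintegral_liminf_le' fun k =>
    (P.aestronglyMeasurable_potential.mul
      ((P.truncSeq k).continuous.aestronglyMeasurable.pow 2)).aemeasurable.ennreal_ofReal)
  filter_upwards [ae_restrict_mem P.domain.isOpen.measurableSet] with x hx
  exact (ENNReal.tendsto_ofReal (((tendsto_truncSeq hx).pow 2).const_mul _)).liminf_eq.ge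

lemma hardyConstant_le (hN : 2 ≤ N) (hn : 2 ≤ n) (P : PoleData N n)
    (hne : (P.domain : Set (E N)).Nonempty) :
    hardyConstant P.domain P.pole ≤ ENNReal.ofReal (P.expo ^ 2) := by
  obtain ⟨b, hb0, hb⟩ := exists_between (pos_iff_ne_zero.2 (lintegral_potential_ne_zero hn
    P.aestronglyMeasurable_groundState (nontrivial_groundState hne)))
  have hlim := ((ENNReal.Tendsto.div_const (P.tendsto_lintegral_remainder_truncSeq hN hn)
    (Or.inr hb0.ne')).const_add (ENNReal.ofReal (P.expo ^ 2)))
  rw [ENNReal.zero_div, add_zero] at hlim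
  refine ge_of_tendsto hlim ?_
  filter_upwards [eventually_lt_of_lt_liminf
    (hb.trans_le P.lintegral_potential_groundState_le_liminf)] with k hk
  have hmem : hardyConstant P.domain P.pole ≤
      quotient P.domain P.pole (P.truncSeq k) (gradient (P.truncSeq k)) :=
    sInf_le ⟨_, _, memD12_testFunction _,
      nontrivial_of_lintegral_potential_ne_zero (hb0.trans hk).ne', rfl⟩
  exact hmem.trans (quotient_testFunction_le (by lia) _ hb0.ne' hb.ne_top hk.le)

theorem hardyConstant_eq (hN : 2 ≤ N) (hn : 2 ≤ n) (P : PoleData N n)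
    (hne : (P.domain : Set (E N)).Nonempty) :
    hardyConstant P.domain P.pole = ENNReal.ofReal (P.expo ^ 2) :=
  le_antisymm (P.hardyConstant_le hN hn hne) (P.le_hardyConstant hn)

end PoleData

namespace PoleData

variable {x : E N}

lemma two_mul_expo_lt (hN : N ≠ 0) (hn : 3 ≤ n) (P : PoleData N n) : 2 * P.expo < N := by
  rw [← P.expo_mul (by lia), mul_comm]
  exact mul_lt_mul_of_pos_left (by exact_mod_cast hn) (P.expo_pos hN (by lia))

lemma lintegral_potential_groundState_ne_top (hN : N ≠ 0) (hn : 3 ≤ n) (P : PoleData N n) :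
    ∫⁻ x in P.domain, ENNReal.ofReal (potential P.pole x * P.groundState x ^ 2) ≠ ⊤ := by
  have : NeZero n := ⟨by lia⟩
  obtain ⟨c, hc0, hc⟩ := P.exists_potential_mul_groundState_sq_le (by lia)
  obtain ⟨C, hC⟩ := P.exists_setLIntegral_le hN
  refine ne_top_of_le_ne_top ENNReal.ofReal_ne_top
    (hC _ (sub_pos.2 (P.two_mul_expo_lt hN hn)) c hc0 _ fun x hx => ?_)
  obtain ⟨k, hk⟩ := P.exists_isNearest x
  exact ⟨k, hc x hx k hk⟩

/-- The gradient `φ ∇ log φ` of the ground state `φ`. -/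
def groundGrad (P : PoleData N n) (x : E N) : E N := P.groundState x • P.logGrad x

lemma aestronglyMeasurable_groundGrad (P : PoleData N n) :
    AEStronglyMeasurable P.groundGrad (volume.restrict P.domain) :=
  P.aestronglyMeasurable_groundState.smul P.aestronglyMeasurable_logGrad

lemma isWeakGradient_groundState (P : PoleData N n) :
    IsWeakGradient P.domain P.groundState P.groundGrad :=
  isWeakGradient_of_contDiffOn P.contDiffOn_groundState fun _ hx => hasGradientAt_groundState hx

lemma truncSeq_nonneg (P : PoleData N n) (k : ℕ) (hx : x ∈ P.domain) : 0 ≤ P.truncSeq k x :=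
  truncation_nonneg _ hx

lemma truncSeq_le_groundState (P : PoleData N n) (k : ℕ) (hx : x ∈ P.domain) :
    P.truncSeq k x ≤ P.groundState x :=
  truncation_le_groundState _ hx

lemma norm_truncSeq_sub_groundState_le (P : PoleData N n) (k : ℕ) (hx : x ∈ P.domain) :
    ‖P.truncSeq k x - P.groundState x‖ ≤ ‖P.groundState x‖ := by
  have h0 := P.truncSeq_nonneg k hx
  have hle := P.truncSeq_le_groundState k hx
  rw [Real.norm_eq_abs, Real.norm_eq_abs, abs_of_pos (groundState_pos hx), abs_le]
  constructor <;> linarith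

lemma lintegral_gradient_truncSeq_le (hn : n ≠ 0) (P : PoleData N n) (k : ℕ) :
    ∫⁻ x in P.domain, ENNReal.ofReal (‖gradient (P.truncSeq k) x‖ ^ 2) ≤
      (∫⁻ x in P.domain,
        ENNReal.ofReal (‖gradient (P.truncSeq k) x - P.truncSeq k x • P.logGrad x‖ ^ 2)) +
      ENNReal.ofReal (P.expo ^ 2) *
        ∫⁻ x in P.domain, ENNReal.ofReal (potential P.pole x * P.groundState x ^ 2) := by
  rw [lintegral_gradient_testFunction hn]
  gcongr _ + _ * ?_
  refine setLIntegral_mono' P.domain.isOpen.measurableSet fun x hx => ?_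
  have := P.truncSeq_nonneg k hx
  have := P.truncSeq_le_groundState k hx
  have := potential_nonneg P.pole x
  gcongr

lemma lintegral_groundGrad_le (hN : 2 ≤ N) (hn : 2 ≤ n) (P : PoleData N n) :
    ∫⁻ x in P.domain, ENNReal.ofReal (‖P.groundGrad x‖ ^ 2) ≤
      ENNReal.ofReal (P.expo ^ 2) *
        ∫⁻ x in P.domain, ENNReal.ofReal (potential P.pole x * P.groundState x ^ 2) := by
  have hlim := (P.tendsto_lintegral_remainder_truncSeq hN hn).add_const
    (ENNReal.ofReal (P.expo ^ 2) *
      ∫⁻ x in P.domain, ENNReal.ofReal (potential P.pole x * P.groundState x ^ 2))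
  rw [zero_add] at hlim
  calc _ ≤ ∫⁻ x in P.domain,
          liminf (fun k => ENNReal.ofReal (‖gradient (P.truncSeq k) x‖ ^ 2)) atTop := by
        refine setLIntegral_mono' P.domain.isOpen.measurableSet fun x hx => ?_
        exact (ENNReal.tendsto_ofReal ((tendsto_gradient_truncSeq hx).norm.pow 2)).liminf_eq.ge
    _ ≤ liminf (fun k => ∫⁻ x in P.domain,
          ENNReal.ofReal (‖gradient (P.truncSeq k) x‖ ^ 2)) atTop :=
        lintegral_liminf_le' fun k => ((continuous_gradient_testFunction
          (P.truncSeq k)).norm.pow 2).measurable.ennreal_ofReal.aemeasurable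
    _ ≤ _ := (liminf_le_liminf (Eventually.of_forall fun k =>
        P.lintegral_gradient_truncSeq_le (by lia) k)).trans_eq hlim.liminf_eq

lemma memLp_groundGrad (hN : 2 ≤ N) (hn : 3 ≤ n) (P : PoleData N n) :
    MemLp P.groundGrad 2 (volume.restrict P.domain) :=
  memLp_two_of_lintegral_ne_top P.aestronglyMeasurable_groundGrad
    (ne_top_of_le_ne_top (ENNReal.mul_ne_top ENNReal.ofReal_ne_top
      (P.lintegral_potential_groundState_ne_top (by lia) hn))
        (P.lintegral_groundGrad_le hN (by lia)))

lemma tendsto_eLpNorm_truncSeq_sub (P : PoleData N n) {s : Set (E N)} (hs : MeasurableSet s)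
    (hsΩ : s ⊆ P.domain) (hφ : MemLp P.groundState 2 (volume.restrict s)) :
    Tendsto (fun k => eLpNorm (fun x => P.truncSeq k x - P.groundState x) 2 (volume.restrict s))
      atTop (𝓝 0) := by
  refine tendsto_eLpNorm_two_zero_of_dominated
    (fun k => (P.truncSeq k).continuous.aestronglyMeasurable.sub hφ.1) hφ (fun k => ?_) ?_
  · filter_upwards [ae_restrict_mem hs] with x hx
    exact P.norm_truncSeq_sub_groundState_le k (hsΩ hx)
  · filter_upwards [ae_restrict_mem hs] with x hx
    simpa only [sub_self] using (tendsto_truncSeq (hsΩ hx)).sub_const (P.groundState x)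

lemma tendsto_eLpNorm_truncSeq_sub_smul_logGrad (P : PoleData N n)
    (hφ : MemLp P.groundGrad 2 (volume.restrict P.domain)) :
    Tendsto (fun k => eLpNorm (fun x => (P.truncSeq k x - P.groundState x) • P.logGrad x) 2
      (volume.restrict P.domain)) atTop (𝓝 0) := by
  have hΩ := ae_restrict_mem (μ := volume) P.domain.isOpen.measurableSet
  refine tendsto_eLpNorm_two_zero_of_dominated (fun k =>
    ((P.truncSeq k).continuous.aestronglyMeasurable.sub P.aestronglyMeasurable_groundState).smul
      P.aestronglyMeasurable_logGrad) hφ.norm (fun k => ?_) ?_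
  · filter_upwards [hΩ] with x hx
    rw [groundGrad, norm_norm, norm_smul, norm_smul]
    gcongr
    exact P.norm_truncSeq_sub_groundState_le k hx
  · filter_upwards [hΩ] with x hx
    simpa only [sub_self, zero_smul] using
      ((tendsto_truncSeq hx).sub_const (P.groundState x)).smul_const (P.logGrad x)

lemma tendsto_eLpNorm_gradient_truncSeq_sub (hN : 2 ≤ N) (hn : 3 ≤ n) (P : PoleData N n) :
    Tendsto (fun k => eLpNorm (fun x => gradient (P.truncSeq k) x - P.groundGrad x) 2
      (volume.restrict P.domain)) atTop (𝓝 0) := by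
  have hlim := (tendsto_eLpNorm_two_zero_of_lintegral
    (P.tendsto_lintegral_remainder_truncSeq hN (by lia))).add
      (P.tendsto_eLpNorm_truncSeq_sub_smul_logGrad (P.memLp_groundGrad hN hn))
  rw [add_zero] at hlim
  refine tendsto_of_tendsto_of_tendsto_of_le_of_le tendsto_const_nhds hlim (fun _ => zero_le)
    fun k => ?_
  have hsplit : (fun x => gradient (P.truncSeq k) x - P.groundGrad x) =
      (fun x => gradient (P.truncSeq k) x - P.truncSeq k x • P.logGrad x) +
        fun x => (P.truncSeq k x - P.groundState x) • P.logGrad x := by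
    ext1 x
    simp only [Pi.add_apply, groundGrad, sub_smul]
    abel
  rw [hsplit]
  exact eLpNorm_add_le ((continuous_gradient_testFunction _).aestronglyMeasurable.sub
    ((P.truncSeq k).continuous.aestronglyMeasurable.smul P.aestronglyMeasurable_logGrad))
    (((P.truncSeq k).continuous.aestronglyMeasurable.sub P.aestronglyMeasurable_groundState).smul
      P.aestronglyMeasurable_logGrad) one_le_two

lemma memD12_groundState (hN : 2 ≤ N) (hn : 3 ≤ n) (P : PoleData N n) :
    MemD12 P.domain P.groundState P.groundGrad := by
  have hloc : ∀ K : Set (E N), IsCompact K → K ⊆ P.domain →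
      MemLp P.groundState 2 (volume.restrict K) := fun K hK hKΩ =>
    memLp_of_continuousOn_of_isCompact hK hK.measurableSet
      ((P.contDiffOn_groundState (m := 0)).continuousOn.mono hKΩ)
  exact ⟨P.aestronglyMeasurable_groundState, hloc, P.memLp_groundGrad hN hn,
    P.isWeakGradient_groundState, P.truncSeq, fun K hK hKΩ =>
      P.tendsto_eLpNorm_truncSeq_sub hK.measurableSet hKΩ (hloc K hK hKΩ),
    P.tendsto_eLpNorm_gradient_truncSeq_sub hN hn⟩

lemma quotient_groundState (hN : 2 ≤ N) (hn : 3 ≤ n) (P : PoleData N n)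
    (hne : (P.domain : Set (E N)).Nonempty) :
    quotient P.domain P.pole P.groundState P.groundGrad = ENNReal.ofReal (P.expo ^ 2) := by
  have henergy : ∫⁻ x in P.domain, ENNReal.ofReal (‖P.groundGrad x‖ ^ 2) =
      ENNReal.ofReal (P.expo ^ 2) *
        ∫⁻ x in P.domain, ENNReal.ofReal (potential P.pole x * P.groundState x ^ 2) :=
    le_antisymm (P.lintegral_groundGrad_le hN (by lia))
      (le_add_self.trans (lintegral_remainder_add_le (by lia) (P.memD12_groundState hN hn)))
  rw [quotient, henergy]
  exact ENNReal.mul_div_cancel_right (lintegral_potential_ne_zero (by lia)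
    P.aestronglyMeasurable_groundState (nontrivial_groundState hne))
    (P.lintegral_potential_groundState_ne_top (by lia) hn)

theorem attainedInD12 (hN : 2 ≤ N) (hn : 3 ≤ n) (P : PoleData N n)
    (hne : (P.domain : Set (E N)).Nonempty) : AttainedInD12 P.domain P.pole :=
  ⟨P.groundState, P.groundGrad, P.memD12_groundState hN hn, nontrivial_groundState hne,
    by rw [P.quotient_groundState hN hn hne, P.hardyConstant_eq hN (by lia) hne]⟩

lemma exists_le_potential (hn : 2 ≤ n) (P : PoleData N n)
    (hb : Bornology.IsBounded (P.domain : Set (E N))) :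
    ∃ c : ℝ, 0 < c ∧ ∀ x ∈ P.domain, c ≤ potential P.pole x := by
  obtain ⟨r, hr⟩ := hb.subset_closedBall 0
  have hij : (⟨0, by lia⟩ : Fin n) < ⟨1, by lia⟩ := by simp
  set i : Fin n := ⟨0, by lia⟩
  set j : Fin n := ⟨1, by lia⟩
  have hsep : 0 < ‖P.pole i - P.pole j‖ :=
    norm_pos_iff.2 (sub_ne_zero.2 (P.injective.ne hij.ne))
  have hdist : ∀ x ∈ P.domain, ∀ k, ‖x - P.pole k‖ ≤ r + ‖P.pole k‖ := fun x hx k =>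
    (norm_sub_le _ _).trans (by gcongr; exact mem_closedBall_zero_iff.1 (hr hx))
  obtain hempty | ⟨x₀, hx₀⟩ := (P.domain : Set (E N)).eq_empty_or_nonempty
  · exact ⟨1, one_pos, fun x hx => absurd hx (by simp [← SetLike.mem_coe, hempty])⟩
  have hi₀ := (norm_sub_pole_pos hx₀ i).trans_le (hdist x₀ hx₀ i)
  have hj₀ := (norm_sub_pole_pos hx₀ j).trans_le (hdist x₀ hx₀ j)
  refine ⟨‖P.pole i - P.pole j‖ ^ 2 / ((r + ‖P.pole i‖) ^ 2 * (r + ‖P.pole j‖) ^ 2),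
    by positivity, fun x hx => le_trans ?_ (P.div_le_potential x hij)⟩
  have hi := norm_sub_pole_pos hx i
  have hj := norm_sub_pole_pos hx j
  gcongr
  exacts [hdist x hx i, hdist x hx j]

lemma memLp_groundState (hN : N ≠ 0) (hn : 3 ≤ n) (P : PoleData N n)
    (hb : Bornology.IsBounded (P.domain : Set (E N))) :
    MemLp P.groundState 2 (volume.restrict P.domain) := by
  obtain ⟨c, hc, hcV⟩ := P.exists_le_potential (by lia) hb
  refine memLp_two_of_lintegral_ne_top P.aestronglyMeasurable_groundState
    (ne_top_of_le_ne_top (ENNReal.mul_ne_top (ENNReal.ofReal_ne_top (r := c⁻¹))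
      (P.lintegral_potential_groundState_ne_top hN hn)) ?_)
  rw [← lintegral_const_mul' _ _ ENNReal.ofReal_ne_top]
  refine setLIntegral_mono' P.domain.isOpen.measurableSet fun x hx => ?_
  rw [← ENNReal.ofReal_mul (by positivity), Real.norm_eq_abs, sq_abs, ← mul_assoc,
    ← div_eq_inv_mul]
  exact ENNReal.ofReal_le_ofReal
    (le_mul_of_one_le_left (sq_nonneg _) ((one_le_div hc).2 (hcV x hx)))

theorem attainedInH10 (hN : 2 ≤ N) (hn : 3 ≤ n) (P : PoleData N n)
    (hne : (P.domain : Set (E N)).Nonempty) (hb : Bornology.IsBounded (P.domain : Set (E N))) :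
    AttainedInH10 P.domain P.pole := by
  have hL2 := P.memLp_groundState (by lia) hn hb
  exact ⟨P.groundState, P.groundGrad, ⟨hL2, P.memLp_groundGrad hN hn,
    P.isWeakGradient_groundState, P.truncSeq,
    P.tendsto_eLpNorm_truncSeq_sub P.domain.isOpen.measurableSet subset_rfl hL2,
    P.tendsto_eLpNorm_gradient_truncSeq_sub hN hn⟩, nontrivial_groundState hne,
    by rw [P.quotient_groundState hN hn hne, P.hardyConstant_eq hN (by lia) hne]⟩

end PoleData

section VanishingGradient

variable {Ω Ω' : Opens (E N)} {u : E N → ℝ} {G : E N → E N}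

lemma integrableOn_of_locallyIntegrableOn_of_eq_zero {X Y : Type*} [TopologicalSpace X]
    [MeasurableSpace X] {μ : Measure X} [NormedAddCommGroup Y] {s K : Set X} {f : X → Y}
    (hs : MeasurableSet s) (hK : IsCompact K) (hKs : K ⊆ s) (hf : LocallyIntegrableOn f s μ)
    (hf0 : ∀ x ∉ K, f x = 0) : IntegrableOn f s μ :=
  (hf.integrableOn_compact_subset hKs hK).of_forall_sdiff_eq_zero hs fun x hx => hf0 x hx.2

lemma locallyIntegrableOn_of_memLp {Y : Type*} [NormedAddCommGroup Y] {f : E N → Y}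
    (hf : ∀ K : Set (E N), IsCompact K → K ⊆ Ω → MemLp f 2 (volume.restrict K)) :
    LocallyIntegrableOn f Ω := by
  rw [locallyIntegrableOn_iff Ω.isOpen.isLocallyClosed]
  intro K hKΩ hK
  have : IsFiniteMeasure (volume.restrict K) := ⟨by simpa using hK.measure_lt_top⟩
  exact (hf K hK hKΩ).integrable one_le_two

lemma IsWeakGradient.mono (h : IsWeakGradient Ω u G) (hΩ : Ω' ≤ Ω) : IsWeakGradient Ω' u G := by
  intro ψ
  have hK := ψ.tsupport_subset
  have h0 : ∀ x ∉ tsupport ψ, ψ x = 0 := fun x => image_eq_zero_of_notMem_tsupport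
  have hψ := h (testFunctionOf Ω ψ ψ.contDiff.contDiffOn (tsupport ψ) ψ.hasCompactSupport
    (hK.trans hΩ) h0)
  change ∫ x in (Ω : Set (E N)), u x • gradient ψ x =
    -∫ x in (Ω : Set (E N)), ψ x • G x at hψ
  have hgrad : ∀ s : Set (E N), tsupport ψ ⊆ s →
      ∫ x in s, u x • gradient ψ x = ∫ x, u x • gradient ψ x := fun s hs =>
    setIntegral_eq_integral_of_forall_compl_eq_zero fun x hx => by
      rw [gradient_eq_zero_of_notMem_tsupport fun h => hx (hs h), smul_zero]
  have hval : ∀ s : Set (E N), tsupport ψ ⊆ s → ∫ x in s, ψ x • G x = ∫ x, ψ x • G x :=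
    fun s hs => setIntegral_eq_integral_of_forall_compl_eq_zero fun x hx => by
      rw [h0 x fun h => hx (hs h), zero_smul]
  rwa [hgrad _ (hK.trans hΩ), hval _ (hK.trans hΩ), ← hgrad _ hK, ← hval _ hK] at hψ

lemma IsWeakGradient.congr {v : E N → ℝ} {H : E N → E N} (h : IsWeakGradient Ω u G)
    (huv : u =ᵐ[volume.restrict Ω] v) (hGH : G =ᵐ[volume.restrict Ω] H) :
    IsWeakGradient Ω v H := fun ψ => by
  rw [← integral_congr_ae (huv.mono fun x hx => congrArg (· • gradient ψ x) hx), h ψ,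
    integral_congr_ae (hGH.mono fun x hx => congrArg (ψ x • ·) hx)]

lemma IsWeakGradient.mul (h : IsWeakGradient Ω u G) (hu : LocallyIntegrableOn u Ω)
    (hG : LocallyIntegrableOn G Ω) {f : E N → ℝ} {F : E N → E N} (hf : ContDiffOn ℝ ∞ f Ω)
    (hF : ∀ x ∈ Ω, HasGradientAt f (F x) x) :
    IsWeakGradient Ω (fun x => u x * f x) (fun x => f x • G x + u x • F x) := by
  intro ψ
  have hΩ := Ω.isOpen.measurableSet
  have hlc := Ω.isOpen.isLocallyClosed
  have hK : IsCompact (tsupport ψ) := ψ.hasCompactSupport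
  have hψ0 : ∀ x ∉ tsupport ψ, ψ x = 0 := fun x => image_eq_zero_of_notMem_tsupport
  have hFc := continuousOn_of_hasGradientAt Ω.isOpen (hf.of_le (by simp)) hF
  let χ : TestFunction Ω ℝ ⊤ := testFunctionOf Ω (fun x => ψ x * f x)
    (ψ.contDiff.contDiffOn.mul hf) (tsupport ψ) hK ψ.tsupport_subset fun x hx => by
      rw [hψ0 x hx, zero_mul]
  have hgrad : ∀ x, gradient χ x = f x • gradient ψ x + ψ x • F x := gradient_testFunction_mul hF ψ
  have hint : ∀ {w : E N → E N}, LocallyIntegrableOn w Ω → IntegrableOn (fun x => ψ x • w x) Ω :=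
    fun hw => integrableOn_of_locallyIntegrableOn_of_eq_zero hΩ hK ψ.tsupport_subset
      (hw.continuousOn_smul hlc ψ.continuous.continuousOn) fun x hx => by rw [hψ0 x hx, zero_smul]
  have hintF := hint (hu.smul_continuousOn hlc hFc)
  have hintG := hint (hG.continuousOn_smul hlc hf.continuousOn)
  have hintχ : IntegrableOn (fun x => u x • gradient χ x) Ω :=
    integrableOn_of_locallyIntegrableOn_of_eq_zero hΩ hK ψ.tsupport_subset
      (hu.smul_continuousOn hlc (continuous_gradient_testFunction χ).continuousOn) fun x hx => by
        rw [hgrad, hψ0 x hx, gradient_eq_zero_of_notMem_tsupport hx]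
        simp
  calc ∫ x in (Ω : Set (E N)), (u x * f x) • gradient ψ x
      = ∫ x in (Ω : Set (E N)), (u x • gradient χ x - ψ x • u x • F x) := by
        refine integral_congr_ae (ae_of_all _ fun x => ?_)
        simp only [hgrad, smul_add, smul_smul, mul_comm (ψ x), add_sub_cancel_right]
    _ = -(∫ x in (Ω : Set (E N)), ψ x • f x • G x) -
          ∫ x in (Ω : Set (E N)), ψ x • u x • F x := by
        rw [integral_sub hintχ hintF, h χ]
        simp only [χ, testFunctionOf_apply, mul_smul]
    _ = _ := by
        simp only [smul_add]
        rw [integral_add hintG hintF, neg_add']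

lemma hasFDerivAt_convolution_eq_zero {ρ g : E N → ℝ} (hg : LocallyIntegrable g)
    (h : IsWeakGradient Ω g 0) (hρ : ContDiff ℝ ∞ ρ) (hρc : HasCompactSupport ρ) {x : E N}
    {r : ℝ} (hxr : Metric.closedBall x r ⊆ Ω) (hρr : tsupport ρ ⊆ Metric.closedBall 0 r) :
    HasFDerivAt (MeasureTheory.convolution ρ g (ContinuousLinearMap.lsmul ℝ ℝ) volume)
      (0 : E N →L[ℝ] ℝ) x := by
  have hψ0 : ∀ y ∉ Metric.closedBall x r, ρ (x - y) = 0 := fun y hy =>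
    image_eq_zero_of_notMem_tsupport fun hmem => hy <| by
      simpa [dist_comm, dist_eq_norm] using hρr hmem
  let ψ : TestFunction Ω ℝ ⊤ := testFunctionOf Ω (fun y => ρ (x - y))
    (hρ.comp (contDiff_const.sub contDiff_id)).contDiffOn (Metric.closedBall x r)
    (isCompact_closedBall _ _) hxr hψ0
  have hψg : ∀ y v, inner ℝ v (gradient ψ y) = -fderiv ℝ ρ (x - y) v := fun y v => by
    have hd : HasFDerivAt ψ ((fderiv ℝ ρ (x - y)).comp (-ContinuousLinearMap.id ℝ (E N))) y :=
      ((hρ.differentiable (by simp) (x - y)).hasFDerivAt).comp y ((hasFDerivAt_id y).const_sub x)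
    rw [real_inner_comm, gradient, InnerProductSpace.toDual_symm_apply, hd.fderiv]
    simp
  have hψ0' : ∀ y ∉ Metric.closedBall x r, gradient ψ y = 0 := fun y hy =>
    gradient_eq_zero_of_notMem_tsupport fun hmem => hy <|
      tsupport_subset_of_forall_notMem_eq_zero Metric.isClosed_closedBall hψ0 hmem
  have hint : Integrable fun y => g y • gradient ψ y :=
    hg.integrable_smul_right_of_hasCompactSupport (continuous_gradient_testFunction ψ)
      (HasCompactSupport.intro (isCompact_closedBall x r) hψ0')
  have hzero : ∫ y, g y • gradient ψ y = 0 := by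
    rw [← setIntegral_eq_integral_of_forall_compl_eq_zero (s := (Ω : Set (E N))) fun y hy => by
      rw [hψ0' y fun hmem => hy (hxr hmem), smul_zero], h ψ]
    simp
  have hex := (hρc.fderiv (𝕜 := ℝ)).convolutionExists_left
    ((ContinuousLinearMap.lsmul ℝ ℝ).precompL (E N)) (hρ.continuous_fderiv (by simp)) hg x
  refine (hρc.hasFDerivAt_convolution_left (ContinuousLinearMap.lsmul ℝ ℝ) (hρ.of_le (by simp))
    hg x).congr_fderiv (ContinuousLinearMap.ext fun v => ?_)
  calc _ = ∫ y, fderiv ℝ ρ y v * g (x - y) := by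
        rw [convolution, ContinuousLinearMap.integral_apply hex]
        simp [ContinuousLinearMap.precompL_apply]
    _ = ∫ y, fderiv ℝ ρ (x - y) v * g (x - (x - y)) :=
        (integral_sub_left_eq_self (fun y => fderiv ℝ ρ y v * g (x - y)) volume x).symm
    _ = -∫ y, inner ℝ v (g y • gradient ψ y) := by
        rw [← integral_neg]
        congr with y
        rw [inner_smul_right, hψg, sub_sub_cancel]
        ring
    _ = 0 := by rw [integral_inner hint, hzero, inner_zero_right, neg_zero]

lemma exists_ae_eq_const_of_isWeakGradient_zero_ball {g : E N → ℝ} (hg : LocallyIntegrable g)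
    {x₀ : E N} {R : ℝ} (hR : 0 < R) (h : IsWeakGradient (ballDomain x₀ R) g 0) :
    ∃ c, ∀ᵐ x ∂volume.restrict (Metric.ball x₀ R), g x = c := by
  let δ : ℕ → ℝ := fun i => 1 / ((i : ℝ) + 1)
  have hδ : ∀ i, 0 < δ i := fun i => Nat.one_div_pos_of_nat
  have hδ0 : Tendsto δ atTop (𝓝 0) := tendsto_one_div_add_atTop_nhds_zero_nat
  let B : ℕ → ContDiffBump (0 : E N) := fun i =>
    ⟨δ i / 2, δ i, half_pos (hδ i), half_lt_self (hδ i)⟩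
  let q : ℕ → E N → ℝ := fun i =>
    convolution ((B i).normed volume) g (ContinuousLinearMap.lsmul ℝ ℝ) volume
  have hq : ∀ i, ∀ x ∈ Metric.ball x₀ (R - δ i), HasFDerivAt (q i) (0 : E N →L[ℝ] ℝ) x :=
    fun i x hx => hasFDerivAt_convolution_eq_zero hg h (B i).contDiff_normed
      (B i).hasCompactSupport_normed (r := δ i)
      (Metric.closedBall_subset_ball' (by linarith [Metric.mem_ball.1 hx]))
      (B i).tsupport_normed_eq.subset
  have hq_const : ∀ i, ∀ x ∈ Metric.ball x₀ (R - δ i), ∀ y ∈ Metric.ball x₀ (R - δ i),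
      q i x = q i y := fun i x hx y hy =>
    Metric.isOpen_ball.is_const_of_fderiv_eq_zero (𝕜 := ℝ) (convex_ball x₀ _).isPreconnected
      (fun z hz => (hq i z hz).differentiableAt.differentiableWithinAt)
      (fun z hz => (hq i z hz).fderiv) hx hy
  have hmem : ∀ x ∈ Metric.ball x₀ R, ∀ᶠ i in atTop, x ∈ Metric.ball x₀ (R - δ i) := by
    intro x hx
    filter_upwards [hδ0.eventually (gt_mem_nhds (sub_pos.2 (Metric.mem_ball.1 hx)))] with i hi
    rw [Metric.mem_ball]
    linarith
  have hlim : ∀ᵐ x, Tendsto (fun i => q i x) atTop (𝓝 (g x)) :=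
    ContDiffBump.ae_convolution_tendsto_right_of_locallyIntegrable (φ := B) (K := 2) hδ0
      (Eventually.of_forall fun i => (mul_div_cancel₀ (δ i) two_ne_zero).ge) hg
  have hlim_ball := (ae_restrict_of_ae (s := Metric.ball x₀ R) hlim).and
    (ae_restrict_mem Metric.isOpen_ball.measurableSet)
  have : (ae (volume.restrict (Metric.ball x₀ R))).NeBot := by
    rw [ae_neBot, Ne, Measure.restrict_eq_zero]
    exact (Metric.measure_ball_pos volume x₀ hR).ne'
  obtain ⟨x₁, hx₁, hx₁R⟩ := hlim_ball.exists
  refine ⟨g x₁, hlim_ball.mono fun x ⟨hx, hxR⟩ => tendsto_nhds_unique_of_eventuallyEq hx hx₁ ?_⟩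
  filter_upwards [hmem x hxR, hmem x₁ hx₁R] with i hi hi₁ using hq_const i x hi x₁ hi₁

lemma exists_ball_ae_eq_const_of_isWeakGradient_zero (hu : LocallyIntegrableOn u Ω)
    (h : IsWeakGradient Ω u 0) {x : E N} (hx : x ∈ Ω) :
    ∃ R > 0, ∃ c, ∀ᵐ y ∂volume.restrict (Metric.ball x R), u y = c := by
  obtain ⟨R, hR, hRΩ⟩ := Metric.nhds_basis_closedBall.mem_iff.1 (Ω.isOpen.mem_nhds hx)
  have hsub : Metric.ball x R ⊆ Metric.closedBall x R := Metric.ball_subset_closedBall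
  have hg : LocallyIntegrable ((Metric.closedBall x R).indicator u) :=
    ((hu.integrableOn_compact_subset hRΩ (isCompact_closedBall x R)).integrable_indicator
      Metric.isClosed_closedBall.measurableSet).locallyIntegrable
  have heq : u =ᵐ[volume.restrict (ballDomain x R)] (Metric.closedBall x R).indicator u :=
    (ae_restrict_mem Metric.isOpen_ball.measurableSet).mono fun y hy =>
      (Set.indicator_of_mem (hsub hy) u).symm
  obtain ⟨c, hc⟩ := exists_ae_eq_const_of_isWeakGradient_zero_ball hg hR
    ((h.mono (show ballDomain x R ≤ Ω from hsub.trans hRΩ)).congr heq EventuallyEq.rfl)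
  exact ⟨R, hR, c, heq.trans hc⟩

lemma exists_ae_eq_const_of_isWeakGradient_zero (hΩ : IsPreconnected (Ω : Set (E N)))
    (hu : LocallyIntegrableOn u Ω) (h : IsWeakGradient Ω u 0) :
    ∃ c, ∀ᵐ x ∂volume.restrict Ω, u x = c := by
  obtain hempty | ⟨x₀, hx₀⟩ := (Ω : Set (E N)).eq_empty_or_nonempty
  · simp [hempty]
  choose! R hR c hc using fun x (hx : x ∈ (Ω : Set (E N))) =>
    exists_ball_ae_eq_const_of_isWeakGradient_zero hu h hx
  have hc_near : ∀ x ∈ (Ω : Set (E N)), ∀ᶠ y in 𝓝[Ω] x, c x = c y := by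
    intro x hx
    filter_upwards [self_mem_nhdsWithin,
      mem_nhdsWithin_of_mem_nhds (Metric.ball_mem_nhds x (hR x hx))] with y hy hyx
    have hpos := (Metric.isOpen_ball.inter Metric.isOpen_ball).measure_pos volume
      ⟨y, hyx, Metric.mem_ball_self (hR y hy)⟩
    have : (ae (volume.restrict (Metric.ball x (R x) ∩ Metric.ball y (R y)))).NeBot := by
      rw [ae_neBot, Ne, Measure.restrict_eq_zero]
      exact hpos.ne'
    obtain ⟨z, hzx, hzy⟩ := ((ae_restrict_of_ae_restrict_of_subset Set.inter_subset_left
      (hc x hx)).and (ae_restrict_of_ae_restrict_of_subset Set.inter_subset_right (hc y hy))).exists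
    rw [← hzx, hzy]
  have hc_const : ∀ x ∈ (Ω : Set (E N)), c x = c x₀ := fun x hx =>
    hΩ.induction₂ (fun x y => c x = c y) hc_near (fun _ _ _ _ _ _ => Eq.trans)
      (fun _ _ _ _ => Eq.symm) hx hx₀
  refine ⟨c x₀, (ae_restrict_iff' Ω.isOpen.measurableSet).2 ?_⟩
  rw [ae_iff]
  refine measure_null_of_locally_null _ fun x hx => ?_
  have hxΩ : x ∈ (Ω : Set (E N)) := (Classical.not_imp.1 hx).1
  have hnull : volume {y | ¬(y ∈ Metric.ball x (R x) → u y = c x)} = 0 :=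
    (ae_restrict_iff' Metric.isOpen_ball.measurableSet).1 (hc x hxΩ)
  refine ⟨_, ?_, hnull⟩
  filter_upwards [self_mem_nhdsWithin,
    mem_nhdsWithin_of_mem_nhds (Metric.ball_mem_nhds x (hR x hxΩ))] with y hy hyx hyc
  exact hy fun _ => (hyc hyx).trans (hc_const x hxΩ)

end VanishingGradient

namespace PoleData

variable {P : PoleData N n} {u : E N → ℝ} {G : E N → E N}

lemma ae_eq_smul_logGrad (hn : n ≠ 0) (h : MemD12 P.domain u G)
    (heq : ∫⁻ x in P.domain, ENNReal.ofReal (‖G x‖ ^ 2) = ENNReal.ofReal (P.expo ^ 2) *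
      ∫⁻ x in P.domain, ENNReal.ofReal (potential P.pole x * u x ^ 2)) :
    ∀ᵐ x ∂volume.restrict P.domain, G x = u x • P.logGrad x := by
  have hle := lintegral_remainder_add_le hn h
  have hfin := h.lintegral_gradient_ne_top
  rw [heq] at hle hfin
  have hzero : ∫⁻ x in P.domain, ENNReal.ofReal (‖G x - u x • P.logGrad x‖ ^ 2) = 0 := by
    by_contra hne
    rw [add_comm] at hle
    exact (ENNReal.lt_add_right hfin hne).not_ge hle
  filter_upwards [(lintegral_eq_zero_iff' ((h.memLp_grad.1.sub (h.aestronglyMeasurable.smul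
    P.aestronglyMeasurable_logGrad)).norm.pow 2).aemeasurable.ennreal_ofReal).1 hzero] with x hx
  exact sub_eq_zero.1 (norm_eq_zero.1 (pow_eq_zero_iff two_ne_zero |>.1
    ((ENNReal.ofReal_eq_zero.1 hx).antisymm (sq_nonneg _))))

lemma isWeakGradient_div_groundState (h : MemD12 P.domain u G)
    (hG : ∀ᵐ x ∂volume.restrict P.domain, G x = u x • P.logGrad x) :
    IsWeakGradient P.domain (fun x => u x * (P.groundState x)⁻¹) 0 := by
  have hΩ := P.domain.isOpen.measurableSet
  have hinv : ∀ x ∈ P.domain, HasGradientAt (fun x => (P.groundState x)⁻¹)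
      (-(P.groundState x ^ 2)⁻¹ • P.groundState x • P.logGrad x) x := fun x hx =>
    hasGradientAt_comp (hasDerivAt_inv (groundState_pos hx).ne') (hasGradientAt_groundState hx)
  refine (h.weakGradient.mul (locallyIntegrableOn_of_memLp h.memLp_loc)
    (locallyIntegrableOn_of_memLp fun _ _ hK =>
      h.memLp_grad.mono_measure (Measure.restrict_mono hK le_rfl))
    (P.contDiffOn_groundState.inv fun x hx => (groundState_pos hx).ne') hinv).congr
    EventuallyEq.rfl ?_
  filter_upwards [hG, ae_restrict_mem hΩ] with x hx hxΩ
  have := (groundState_pos hxΩ).ne'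
  have hcoef : (P.groundState x)⁻¹ * u x +
      u x * -(P.groundState x ^ 2)⁻¹ * P.groundState x = 0 := by
    field_simp
    ring
  rw [hx, Pi.inv_apply, smul_smul, smul_smul, smul_smul, ← add_smul, hcoef, zero_smul,
    Pi.zero_apply]

lemma exists_ae_eq_const_mul_groundState (hΩ : IsPreconnected (P.domain : Set (E N)))
    (h : MemD12 P.domain u G) (hG : ∀ᵐ x ∂volume.restrict P.domain, G x = u x • P.logGrad x) :
    ∃ c, ∀ᵐ x ∂volume.restrict P.domain, u x = c * P.groundState x := by
  have hinv : ContinuousOn (fun x => (P.groundState x)⁻¹) P.domain :=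
    (P.contDiffOn_groundState (m := 0)).continuousOn.inv₀ fun x hx => (groundState_pos hx).ne'
  obtain ⟨c, hc⟩ := exists_ae_eq_const_of_isWeakGradient_zero hΩ
    ((locallyIntegrableOn_of_memLp h.memLp_loc).mul_continuousOn hinv
      P.domain.isOpen.isLocallyClosed) (isWeakGradient_div_groundState h hG)
  refine ⟨c, ?_⟩
  filter_upwards [hc, ae_restrict_mem P.domain.isOpen.measurableSet] with x hx hxΩ
  rw [← hx, inv_mul_cancel_right₀ (groundState_pos hxΩ).ne']

lemma lintegral_potential_ne_top (hN : N ≠ 0) (hn : n ≠ 0) (h : MemD12 P.domain u G) :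
    ∫⁻ x in P.domain, ENNReal.ofReal (potential P.pole x * u x ^ 2) ≠ ⊤ := by
  have hexpo : ENNReal.ofReal (P.expo ^ 2) ≠ 0 :=
    (ENNReal.ofReal_pos.2 (pow_pos (P.expo_pos hN hn) 2)).ne'
  intro htop
  have hle := le_add_self.trans (lintegral_remainder_add_le hn h)
  rw [htop, ENNReal.mul_top hexpo] at hle
  exact h.lintegral_gradient_ne_top (top_le_iff.1 hle)

lemma lintegral_potential_const_mul_groundState {c : ℝ}
    (hu : ∀ᵐ x ∂volume.restrict P.domain, u x = c * P.groundState x) :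
    ∫⁻ x in P.domain, ENNReal.ofReal (potential P.pole x * u x ^ 2) = ENNReal.ofReal (c ^ 2) *
      ∫⁻ x in P.domain, ENNReal.ofReal (potential P.pole x * P.groundState x ^ 2) := by
  rw [← lintegral_const_mul' _ _ ENNReal.ofReal_ne_top]
  refine lintegral_congr_ae (hu.mono fun x hx => ?_)
  simp only [hx, ← ENNReal.ofReal_mul (sq_nonneg c)]
  ring_nf

theorem not_attainedInD12_of_lintegral_eq_top (hN : 2 ≤ N) (hn : 2 ≤ n) (P : PoleData N n)
    (hΩ : IsPreconnected (P.domain : Set (E N)))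
    (htop : ∫⁻ x in P.domain, ENNReal.ofReal (potential P.pole x * P.groundState x ^ 2) = ⊤) :
    ¬AttainedInD12 P.domain P.pole := by
  rintro ⟨u, G, hu, hu0, hquot⟩
  have hne : (P.domain : Set (E N)).Nonempty :=
    Set.nonempty_iff_ne_empty.2 fun hempty => by simp [hempty] at htop
  have hfin := lintegral_potential_ne_top (by lia) (by lia) hu
  rw [P.hardyConstant_eq hN hn hne, quotient, eq_comm, ENNReal.eq_div_iff
    (lintegral_potential_ne_zero hn hu.aestronglyMeasurable hu0) hfin, mul_comm] at hquot
  have hG := ae_eq_smul_logGrad (by lia) hu hquot.symm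
  obtain ⟨c, hc⟩ := exists_ae_eq_const_mul_groundState hΩ hu hG
  have hc0 : c ≠ 0 := by
    rintro rfl
    exact hu0 (hc.mono fun x hx => by simp [hx])
  refine hfin ?_
  rw [lintegral_potential_const_mul_groundState hc, htop, ENNReal.mul_top]
  exact (ENNReal.ofReal_pos.2 (by positivity)).ne'

end PoleData

lemma AttainedInH10.attainedInD12 {Ω : Opens (E N)} {a : Fin n → E N} :
    AttainedInH10 Ω a → AttainedInD12 Ω a := fun ⟨u, G, hu, hquot⟩ => ⟨u, G, hu.memD12, hquot⟩

lemma setLIntegral_eq_top_of_le_on_balls (hN : N ≠ 0) {s : Set (E N)} {f : E N → ℝ≥0∞} {c : ℝ}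
    (hc : 0 < c) {z : ℕ → E N} {t : ℕ → ℝ} (ht0 : ∀ k, 0 < t k) (ht : Tendsto t atTop (𝓝 0))
    (hs : ∀ k, Metric.ball (z k) (t k) ⊆ s)
    (hf : ∀ k, ∀ x ∈ Metric.ball (z k) (t k), ENNReal.ofReal (c / t k ^ N) ≤ f x) :
    ∫⁻ x in s, f x = ⊤ := by
  by_contra hfin
  set v := volume (Metric.ball (0 : E N) 1)
  have hv0 : v ≠ 0 := (Metric.measure_ball_pos volume _ one_pos).ne'
  have hv : ∀ k, volume (Metric.ball (z k) (t k)) = ENNReal.ofReal (t k ^ N) * v := fun k => by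
    rw [Measure.addHaar_ball_of_pos volume _ (ht0 k), finrank_euclideanSpace_fin]
  have hvol : Tendsto (volume.restrict s ∘ fun k => Metric.ball (z k) (t k)) atTop (𝓝 0) := by
    have hlim := ENNReal.Tendsto.mul_const (ENNReal.tendsto_ofReal (ht.pow N))
      (Or.inr (measure_ball_lt_top (x := (0 : E N)) (r := 1) (μ := volume)).ne)
    rw [zero_pow hN, ENNReal.ofReal_zero, zero_mul] at hlim
    exact tendsto_of_tendsto_of_tendsto_of_le_of_le tendsto_const_nhds hlim (fun _ => zero_le)
      fun k => (Measure.restrict_apply_le _ _).trans (hv k).le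
  have hlow : ∀ k, ENNReal.ofReal c * v ≤
      ∫⁻ x in Metric.ball (z k) (t k), f x ∂volume.restrict s := fun k =>
    calc ENNReal.ofReal c * v
        = ∫⁻ _ in Metric.ball (z k) (t k), ENNReal.ofReal (c / t k ^ N) := by
          have := ht0 k
          rw [setLIntegral_const, hv, ← mul_assoc, ← ENNReal.ofReal_mul (by positivity),
            div_mul_cancel₀ _ (by positivity)]
      _ ≤ _ := by
          rw [Measure.restrict_restrict_of_subset (hs k)]
          exact setLIntegral_mono' Metric.isOpen_ball.measurableSet (hf k)
  refine (ge_of_tendsto' (tendsto_setLIntegral_zero hfin hvol) hlow).not_gt ?_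
  exact ENNReal.mul_pos (ENNReal.ofReal_pos.2 hc).ne' hv0

lemma dist_lt_of_mem_ball_lineMap {p x₀ x : E N} {r t : ℝ} (hr : 0 < r) (hp : dist p x₀ = r)
    (ht0 : 0 ≤ t) (htr : 2 * t ≤ r)
    (hx : x ∈ Metric.ball (AffineMap.lineMap p x₀ (2 * t / r)) t) :
    dist x x₀ < r - t ∧ dist x p < 3 * t := by
  have hcoef : 0 ≤ 1 - 2 * t / r := sub_nonneg.2 ((div_le_one hr).2 htr)
  have hcentre : dist (AffineMap.lineMap p x₀ (2 * t / r)) x₀ = r - 2 * t := by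
    rw [dist_lineMap_right, Real.norm_of_nonneg hcoef, hp, sub_mul, one_mul,
      div_mul_cancel₀ _ hr.ne']
  have hpole : dist (AffineMap.lineMap p x₀ (2 * t / r)) p = 2 * t := by
    rw [dist_lineMap_left, Real.norm_of_nonneg (by positivity), hp, div_mul_cancel₀ _ hr.ne']
  constructor
  · linarith [dist_triangle x (AffineMap.lineMap p x₀ (2 * t / r)) x₀, Metric.mem_ball.1 hx]
  · linarith [dist_triangle x (AffineMap.lineMap p x₀ (2 * t / r)) p, Metric.mem_ball.1 hx]

namespace PoleData

lemma potential_mul_groundState_sq {P : PoleData N 2} {x : E N} (hx : x ∈ P.domain) :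
    potential P.pole x * P.groundState x ^ 2 = P.height x ^ 2 * ‖P.pole 0 - P.pole 1‖ ^ 2 /
      (‖x - P.pole 0‖ * ‖x - P.pole 1‖) ^ (N + 2) := by
  have hIoi₀ : Finset.Ioi (0 : Fin 2) = {1} := rfl
  have hIoi₁ : Finset.Ioi (1 : Fin 2) = ∅ := rfl
  have hexpo : -(2 * P.expo) = -(N : ℝ) := by
    rw [expo]
    push_cast
    ring
  have h₀ := norm_sub_pole_pos hx 0
  have h₁ := norm_sub_pole_pos hx 1
  rw [groundState, mul_pow, weight_sq hx, potential, Fin.sum_univ_two, Fin.prod_univ_two, hIoi₀,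
    hIoi₁, Finset.sum_singleton, Finset.sum_empty, add_zero, hexpo, Real.rpow_neg h₀.le,
    Real.rpow_neg h₁.le, Real.rpow_natCast, Real.rpow_natCast, pow_add]
  field_simp
  ring

lemma div_le_potential_mul_groundState_sq {P : PoleData N 2} {x : E N} {r t : ℝ} (hr : 0 < r)
    (ht : 0 < t) (hheight : t * r ≤ P.height x) (h₀ : ‖x - P.pole 0‖ ≤ 3 * t)
    (h₁ : ‖x - P.pole 1‖ ≤ 2 * r) :
    ‖P.pole 0 - P.pole 1‖ ^ 2 / (36 * (6 * r) ^ N) / t ^ N ≤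
      potential P.pole x * P.groundState x ^ 2 := by
  have hx : x ∈ P.domain := (mul_pos ht hr).trans_le hheight
  have hpos₀ := norm_sub_pole_pos hx 0
  have hpos₁ := norm_sub_pole_pos hx 1
  rw [potential_mul_groundState_sq hx]
  calc ‖P.pole 0 - P.pole 1‖ ^ 2 / (36 * (6 * r) ^ N) / t ^ N
      = (t * r) ^ 2 * ‖P.pole 0 - P.pole 1‖ ^ 2 / (3 * t * (2 * r)) ^ (N + 2) := by
        have : 3 * t * (2 * r) = 6 * r * t := by ring
        rw [this, pow_add, mul_pow (6 * r) t N]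
        field_simp
        norm_num
    _ ≤ _ := by gcongr

lemma lintegral_potential_groundState_eq_top (hN : N ≠ 0) (P : PoleData N 2) {x₀ : E N} {r : ℝ}
    (hr : 0 < r) (hheight : ∀ x, P.height x = r ^ 2 - ‖x - x₀‖ ^ 2) :
    ∫⁻ x in P.domain, ENNReal.ofReal (potential P.pole x * P.groundState x ^ 2) = ⊤ := by
  have hpole : ∀ i, dist (P.pole i) x₀ = r := fun i => by
    have h0 : P.height (P.pole i) = 0 := P.height_pole i
    rw [hheight, sub_eq_zero] at h0
    rw [dist_eq_norm]
    exact ((pow_left_inj₀ hr.le (norm_nonneg _) two_ne_zero).1 h0).symm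
  have hd : 0 < ‖P.pole 0 - P.pole 1‖ :=
    norm_pos_iff.2 (sub_ne_zero.2 (P.injective.ne zero_ne_one))
  let t : ℕ → ℝ := fun k => r / 2 * (1 / ((k : ℝ) + 1))
  have ht0 : ∀ k, 0 < t k := fun k => by positivity
  have htr : ∀ k, 2 * t k ≤ r := fun k => by
    have : (1 : ℝ) / (k + 1) ≤ 1 := Nat.one_div_le_one_div k.zero_le |>.trans (by simp)
    simp only [t]
    nlinarith
  have ht : Tendsto t atTop (𝓝 0) := by
    have hlim := (tendsto_one_div_add_atTop_nhds_zero_nat (𝕜 := ℝ)).const_mul (r / 2)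
    rwa [mul_zero] at hlim
  let z : ℕ → E N := fun k => AffineMap.lineMap (P.pole 0) x₀ (2 * t k / r)
  have hx : ∀ k, ∀ x ∈ Metric.ball (z k) (t k), t k * r ≤ P.height x ∧
      ‖x - P.pole 0‖ ≤ 3 * t k ∧ ‖x - P.pole 1‖ ≤ 2 * r := fun k x hx => by
    obtain ⟨hx₀, hxp⟩ := dist_lt_of_mem_ball_lineMap hr (hpole 0) (ht0 k).le (htr k) hx
    have htri := dist_triangle_right x (P.pole 1) x₀
    rw [hpole] at htri
    rw [hheight, ← dist_eq_norm, ← dist_eq_norm, ← dist_eq_norm]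
    refine ⟨?_, hxp.le, by linarith [ht0 k]⟩
    nlinarith [dist_nonneg (x := x) (y := x₀), ht0 k, htr k]
  have hsub : ∀ k, Metric.ball (z k) (t k) ⊆ P.domain := fun k x hxk =>
    (mul_pos (ht0 k) hr).trans_le (hx k x hxk).1
  refine setLIntegral_eq_top_of_le_on_balls hN
    (c := ‖P.pole 0 - P.pole 1‖ ^ 2 / (36 * (6 * r) ^ N)) (by positivity) ht0 ht hsub
    fun k x hxk => ?_
  obtain ⟨hh, h₀, h₁⟩ := hx k x hxk
  exact ENNReal.ofReal_le_ofReal (div_le_potential_mul_groundState_sq hr (ht0 k) hh h₀ h₁)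

end PoleData

/-- The pole data of distinct points on the sphere of centre `x₀` and radius `r`. Its region is the
ball for `s = 1` and the exterior of the ball for `s = -1`. -/
def spherePoleData (x₀ : E N) (r s : ℝ) (a : Fin n → E N) (ha : Function.Injective a)
    (hr : ∀ i, ‖a i - x₀‖ = r) : PoleData N n where
  curv := -s
  lin := (2 * s) • x₀
  cst := s * (r ^ 2 - ‖x₀‖ ^ 2)
  pole := a
  injective := ha
  height_pole i := by
    rw [← hr i, norm_sub_sq_real, real_inner_smul_left, real_inner_comm]
    ring

lemma height_spherePoleData {x₀ : E N} {r s : ℝ} {a : Fin n → E N} (ha : Function.Injective a)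
    (hr : ∀ i, ‖a i - x₀‖ = r) (x : E N) :
    (spherePoleData x₀ r s a ha hr).height x = s * (r ^ 2 - ‖x - x₀‖ ^ 2) := by
  rw [PoleData.height, spherePoleData, norm_sub_sq_real, real_inner_smul_left, real_inner_comm]
  ring

/-- The pole data of distinct points on the hyperplane `⟨α, x⟩ = b`. -/
def hyperplanePoleData (α : E N) (b : ℝ) (a : Fin n → E N) (ha : Function.Injective a)
    (hb : ∀ i, inner ℝ α (a i) = b) : PoleData N n where
  curv := 0
  lin := α
  cst := -b
  pole := a
  injective := ha
  height_pole i := by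
    rw [hb]
    ring

lemma exists_poleData_ballDomain {x₀ : E N} {r : ℝ} (hr : 0 < r) {a : Fin n → E N}
    (ha : Function.Injective a) (hfr : ∀ i, a i ∈ frontier (ballDomain x₀ r : Set (E N))) :
    ∃ P : PoleData N n, P.pole = a ∧ P.domain = ballDomain x₀ r ∧
      ∀ x, P.height x = r ^ 2 - ‖x - x₀‖ ^ 2 := by
  have hsphere : ∀ i, ‖a i - x₀‖ = r := fun i =>
    mem_sphere_iff_norm.1 (frontier_ball x₀ hr.ne' ▸ hfr i)
  have hheight : ∀ x, (spherePoleData x₀ r 1 a ha hsphere).height x = r ^ 2 - ‖x - x₀‖ ^ 2 :=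
    fun x => (height_spherePoleData ha hsphere x).trans (one_mul _)
  refine ⟨_, rfl, Opens.ext (Set.ext fun x => ?_), hheight⟩
  change 0 < (spherePoleData x₀ r 1 a ha hsphere).height x ↔ x ∈ Metric.ball x₀ r
  rw [hheight, sub_pos, sq_lt_sq₀ (norm_nonneg _) hr.le, mem_ball_iff_norm]

lemma exists_poleData_exteriorDomain {x₀ : E N} {r : ℝ} (hr : 0 < r) {a : Fin n → E N}
    (ha : Function.Injective a) (hfr : ∀ i, a i ∈ frontier (exteriorDomain x₀ r : Set (E N))) :
    ∃ P : PoleData N n, P.pole = a ∧ P.domain = exteriorDomain x₀ r := by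
  have hsphere : ∀ i, ‖a i - x₀‖ = r := fun i => by
    have hi : a i ∈ frontier (Metric.closedBall x₀ r)ᶜ := hfr i
    rwa [frontier_compl, frontier_closedBall x₀ hr.ne', mem_sphere_iff_norm] at hi
  refine ⟨spherePoleData x₀ r (-1) a ha hsphere, rfl, Opens.ext (Set.ext fun x => ?_)⟩
  change 0 < (spherePoleData x₀ r (-1) a ha hsphere).height x ↔ x ∈ (Metric.closedBall x₀ r)ᶜ
  rw [height_spherePoleData, neg_one_mul, neg_sub, sub_pos, sq_lt_sq₀ hr.le (norm_nonneg _),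
    Set.mem_compl_iff, mem_closedBall_iff_norm, not_le]

lemma exists_poleData_halfSpaceDomain {α : E N} {b : ℝ} {a : Fin n → E N}
    (ha : Function.Injective a) (hfr : ∀ i, a i ∈ frontier (halfSpaceDomain α b : Set (E N))) :
    ∃ P : PoleData N n, P.pole = a ∧ P.domain = halfSpaceDomain α b := by
  have hplane : ∀ i, inner ℝ α (a i) = b := fun i =>
    (frontier_lt_subset_eq continuous_const (by fun_prop) (hfr i)).symm
  refine ⟨hyperplanePoleData α b a ha hplane, rfl, Opens.ext (Set.ext fun x => ?_)⟩
  change 0 < 0 * ‖x‖ ^ 2 + inner ℝ α x + -b ↔ b < inner ℝ α x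
  rw [zero_mul, zero_add, ← sub_eq_add_neg, sub_pos]

lemma nonempty_exteriorDomain (hN : N ≠ 0) (x₀ : E N) (r : ℝ) :
    (exteriorDomain x₀ r : Set (E N)).Nonempty := by
  have : Nonempty (Fin N) := ⟨⟨0, Nat.pos_of_ne_zero hN⟩⟩
  obtain ⟨v, hv⟩ := exists_norm_eq (E N) (by positivity : 0 ≤ |r| + 1)
  refine ⟨x₀ + v, ?_⟩
  change x₀ + v ∈ (Metric.closedBall x₀ r)ᶜ
  rw [Set.mem_compl_iff, mem_closedBall_iff_norm, add_sub_cancel_left, hv]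
  linarith [le_abs_self r]

lemma nonempty_halfSpaceDomain {α : E N} (hα : α ≠ 0) (b : ℝ) :
    (halfSpaceDomain α b : Set (E N)).Nonempty := by
  refine ⟨((b + 1) / ‖α‖ ^ 2) • α, ?_⟩
  change b < inner ℝ α (((b + 1) / ‖α‖ ^ 2) • α)
  have : ‖α‖ ≠ 0 := norm_ne_zero_iff.2 hα
  rw [inner_smul_right, real_inner_self_eq_norm_sq, div_mul_cancel₀ _ (by positivity)]
  exact lt_add_one b

section Domains

variable {a : Fin n → E N} {x₀ α : E N} {r b : ℝ}

lemma PoleData.hardyConstant_eq_ofReal (hN : 2 ≤ N) (hn : 2 ≤ n) (P : PoleData N n)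
    (hne : (P.domain : Set (E N)).Nonempty) :
    hardyConstant P.domain P.pole = ENNReal.ofReal ((N : ℝ) ^ 2 / (n : ℝ) ^ 2) := by
  rw [P.hardyConstant_eq hN hn hne, expo, div_pow]

theorem hardyConstant_ballDomain (hN : 2 ≤ N) (hn : 2 ≤ n) (ha : Function.Injective a)
    (hr : 0 < r) (hfr : ∀ i, a i ∈ frontier (ballDomain x₀ r : Set (E N))) :
    hardyConstant (ballDomain x₀ r) a = ENNReal.ofReal ((N : ℝ) ^ 2 / (n : ℝ) ^ 2) := by
  obtain ⟨P, rfl, hdom, -⟩ := exists_poleData_ballDomain hr ha hfr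
  rw [← hdom]
  exact P.hardyConstant_eq_ofReal hN hn (hdom ▸ Metric.nonempty_ball.2 hr)

theorem attainedInH10_ballDomain_iff (hN : 2 ≤ N) (hn : 2 ≤ n) (ha : Function.Injective a)
    (hr : 0 < r) (hfr : ∀ i, a i ∈ frontier (ballDomain x₀ r : Set (E N))) :
    AttainedInH10 (ballDomain x₀ r) a ↔ 3 ≤ n := by
  obtain ⟨P, rfl, hdom, hheight⟩ := exists_poleData_ballDomain hr ha hfr
  rw [← hdom]
  refine ⟨fun hatt => ?_, fun hn3 => P.attainedInH10 hN hn3 (hdom ▸ Metric.nonempty_ball.2 hr)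
    (hdom ▸ Metric.isBounded_ball)⟩
  by_contra hn3
  obtain rfl : n = 2 := by lia
  exact P.not_attainedInD12_of_lintegral_eq_top hN hn (hdom ▸ (convex_ball x₀ r).isPreconnected)
    (P.lintegral_potential_groundState_eq_top (by lia) hr hheight) hatt.attainedInD12

theorem hardyConstant_exteriorDomain (hN : 2 ≤ N) (hn : 2 ≤ n) (ha : Function.Injective a)
    (hr : 0 < r) (hfr : ∀ i, a i ∈ frontier (exteriorDomain x₀ r : Set (E N))) :
    hardyConstant (exteriorDomain x₀ r) a = ENNReal.ofReal ((N : ℝ) ^ 2 / (n : ℝ) ^ 2) := by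
  obtain ⟨P, rfl, hdom⟩ := exists_poleData_exteriorDomain hr ha hfr
  rw [← hdom]
  exact P.hardyConstant_eq_ofReal hN hn (hdom ▸ nonempty_exteriorDomain (by lia) x₀ r)

theorem attainedInD12_exteriorDomain (hN : 2 ≤ N) (hn : 3 ≤ n) (ha : Function.Injective a)
    (hr : 0 < r) (hfr : ∀ i, a i ∈ frontier (exteriorDomain x₀ r : Set (E N))) :
    AttainedInD12 (exteriorDomain x₀ r) a := by
  obtain ⟨P, rfl, hdom⟩ := exists_poleData_exteriorDomain hr ha hfr
  rw [← hdom]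
  exact P.attainedInD12 hN hn (hdom ▸ nonempty_exteriorDomain (by lia) x₀ r)

theorem hardyConstant_halfSpaceDomain (hN : 2 ≤ N) (hn : 2 ≤ n) (ha : Function.Injective a)
    (hα : α ≠ 0) (hfr : ∀ i, a i ∈ frontier (halfSpaceDomain α b : Set (E N))) :
    hardyConstant (halfSpaceDomain α b) a = ENNReal.ofReal ((N : ℝ) ^ 2 / (n : ℝ) ^ 2) := by
  obtain ⟨P, rfl, hdom⟩ := exists_poleData_halfSpaceDomain ha hfr
  rw [← hdom]
  exact P.hardyConstant_eq_ofReal hN hn (hdom ▸ nonempty_halfSpaceDomain hα b)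

theorem attainedInD12_halfSpaceDomain (hN : 2 ≤ N) (hn : 3 ≤ n) (ha : Function.Injective a)
    (hα : α ≠ 0) (hfr : ∀ i, a i ∈ frontier (halfSpaceDomain α b : Set (E N))) :
    AttainedInD12 (halfSpaceDomain α b) a := by
  obtain ⟨P, rfl, hdom⟩ := exists_poleData_halfSpaceDomain ha hfr
  rw [← hdom]
  exact P.attainedInD12 hN hn (hdom ▸ nonempty_halfSpaceDomain hα b)

end Domains

end MultipolarHardy

end

theorem theorem3_general (N n : ℕ) (hN : 2 ≤ N) (hn : 2 ≤ n)
    (a : Fin n → EuclideanSpace ℝ (Fin N)) (ha : Function.Injective a) :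
    (∀ (x₀ : EuclideanSpace ℝ (Fin N)) (r : ℝ), 0 < r →
      (∀ i, a i ∈ frontier (MultipolarHardy.ballDomain x₀ r : Set (EuclideanSpace ℝ (Fin N)))) →
        MultipolarHardy.hardyConstant (MultipolarHardy.ballDomain x₀ r) a
          = ENNReal.ofReal ((N : ℝ) ^ 2 / (n : ℝ) ^ 2) ∧
        (MultipolarHardy.AttainedInH10 (MultipolarHardy.ballDomain x₀ r) a ↔ 3 ≤ n)) ∧
    (∀ (x₀ : EuclideanSpace ℝ (Fin N)) (r : ℝ), 0 < r →
      (∀ i, a i ∈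
        frontier (MultipolarHardy.exteriorDomain x₀ r : Set (EuclideanSpace ℝ (Fin N)))) →
        MultipolarHardy.hardyConstant (MultipolarHardy.exteriorDomain x₀ r) a
          = ENNReal.ofReal ((N : ℝ) ^ 2 / (n : ℝ) ^ 2) ∧
        (3 ≤ n → MultipolarHardy.AttainedInD12 (MultipolarHardy.exteriorDomain x₀ r) a)) ∧
    (∀ (α : EuclideanSpace ℝ (Fin N)) (b : ℝ), α ≠ 0 →
      (∀ i, a i ∈
        frontier (MultipolarHardy.halfSpaceDomain α b : Set (EuclideanSpace ℝ (Fin N)))) →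
        MultipolarHardy.hardyConstant (MultipolarHardy.halfSpaceDomain α b) a
          = ENNReal.ofReal ((N : ℝ) ^ 2 / (n : ℝ) ^ 2) ∧
        (3 ≤ n → MultipolarHardy.AttainedInD12 (MultipolarHardy.halfSpaceDomain α b) a)) :=
  ⟨fun _ _ hr hfr => ⟨MultipolarHardy.hardyConstant_ballDomain hN hn ha hr hfr,
      MultipolarHardy.attainedInH10_ballDomain_iff hN hn ha hr hfr⟩,
    fun _ _ hr hfr => ⟨MultipolarHardy.hardyConstant_exteriorDomain hN hn ha hr hfr,
      fun hn3 => MultipolarHardy.attainedInD12_exteriorDomain hN hn3 ha hr hfr⟩,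
    fun _ _ hα hfr => ⟨MultipolarHardy.hardyConstant_halfSpaceDomain hN hn ha hα hfr,
      fun hn3 => MultipolarHardy.attainedInD12_halfSpaceDomain hN hn3 ha hα hfr⟩⟩

theorem theorem3 (N n : ℕ) (hN : 2 ≤ N) (hn : 2 ≤ n)
    (a : Fin n → EuclideanSpace ℝ (Fin N)) (ha : Function.Injective a) :
    (∀ (x₀ : EuclideanSpace ℝ (Fin N)) (r : ℝ), 0 < r →
      (∀ i, a i ∈ frontier (MultipolarHardy.ballDomain x₀ r : Set (EuclideanSpace ℝ (Fin N)))) →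
        MultipolarHardy.hardyConstant (MultipolarHardy.ballDomain x₀ r) a
          = ENNReal.ofReal ((N : ℝ) ^ 2 / (n : ℝ) ^ 2) ∧
        (MultipolarHardy.AttainedInH10 (MultipolarHardy.ballDomain x₀ r) a ↔ 3 ≤ n)) ∧
    (∀ (x₀ : EuclideanSpace ℝ (Fin N)) (r : ℝ), 0 < r →
      (∀ i, a i ∈
        frontier (MultipolarHardy.exteriorDomain x₀ r : Set (EuclideanSpace ℝ (Fin N)))) →
        MultipolarHardy.hardyConstant (MultipolarHardy.exteriorDomain x₀ r) a
          = ENNReal.ofReal ((N : ℝ) ^ 2 / (n : ℝ) ^ 2) ∧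
        (3 ≤ N → 3 ≤ n →
          MultipolarHardy.AttainedInD12 (MultipolarHardy.exteriorDomain x₀ r) a)) ∧
    (∀ (α : EuclideanSpace ℝ (Fin N)) (b : ℝ), α ≠ 0 →
      (∀ i, a i ∈
        frontier (MultipolarHardy.halfSpaceDomain α b : Set (EuclideanSpace ℝ (Fin N)))) →
        MultipolarHardy.hardyConstant (MultipolarHardy.halfSpaceDomain α b) a
          = ENNReal.ofReal ((N : ℝ) ^ 2 / (n : ℝ) ^ 2) ∧
        (3 ≤ n → MultipolarHardy.AttainedInD12 (MultipolarHardy.halfSpaceDomain α b) a)) := by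
  obtain ⟨hball, hext, hhalf⟩ := theorem3_general N n hN hn a ha
  exact ⟨hball, fun x₀ r hr hfr => (hext x₀ r hr hfr).imp_right fun h _ => h, hhalf⟩
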